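/- Consider the network creation game with a set $V$ of $n\ge 2$ agents and edge price $\alpha>0$, $\alpha\in\mathbb R$. Each agent $u$ chooses a strategy $S_u\subseteq V\setminus\{u\}$; a strategy vector $\mathbf s=(S_u)_{u\in V}$ induces the undirected network $G(\mathbf s)$ on $V$ in which $u$ and $v$ are adjacent if and only if $v\in S_u$ or $u\in S_v$. The cost of agent $u$ is $\alpha|S_u|+\sum_{w\in V}d_{G(\mathbf s)}(u,w)$ if $G(\mathbf s)$ is connected, and $\infty$ otherwise, where $d_{G(\mathbf s)}$ denotes the shortest-path distance; the social cost is the sum of the costs of all agents. A strategy vector is a (pure) Nash equilibrium if no agent can strictly decrease her cost by changing her own strategy while all others keep theirs. Let $\mathrm{OPT}_n$ be the minimum social cost over all strategy vectors, and let $\mathrm{maxNE}_n$ be the maximum social cost over all Nash equilibria; the price of anarchy of the game with $n$ agents and edge price $\alpha$ is $\mathrm{maxNE}_n/\mathrm{OPT}_n$. If $\alpha>4n-13$, then a Nash equilibrium exists and the price of anarchy satisfies $$\frac{\mathrm{maxNE}_n}{\mathrm{OPT}_n}\;\le\; 3+\frac{2n}{2n+\alpha}.$$ In particular, the price of anarchy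 is at most $5$. -/

import Mathlib

open scoped ENNReal

noncomputable section

namespace NetworkCreation

/-- A strategy vector: every agent `u` chooses a set of agents other than `u` to whom she buys
an edge. -/
abbrev Profile (V : Type*) : Type _ := (u : V) → {S : Finset V // u ∉ S}

/-- The undirected network induced by a strategy vector. -/
def network {V : Type*} (s : Profile V) : SimpleGraph V where
  Adj u v := v ∈ (s u).1 ∨ u ∈ (s v).1
  symm := ⟨fun _ _ h => h.symm⟩
  loopless := ⟨fun u h => h.elim (s u).2 (s u).2⟩

open Classical in
/-- The distance cost of agent `u`: the sum of her distances to all agents, and `∞` if the network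
is not connected. -/
def distCost {V : Type*} [Fintype V] (G : SimpleGraph V) (u : V) : ℝ≥0∞ :=
  if G.Connected then ∑ w, (G.dist u w : ℝ≥0∞) else ⊤

/-- The cost of agent `u` at edge price `α`: creation cost plus distance cost. -/
def agentCost {V : Type*} [Fintype V] (α : ℝ) (s : Profile V) (u : V) : ℝ≥0∞ :=
  ENNReal.ofReal α * ((s u).1.card : ℝ≥0∞) + distCost (network s) u

/-- The social cost: the sum of the costs of all agents. -/
def socialCost {V : Type*} [Fintype V] (α : ℝ) (s : Profile V) : ℝ≥0∞ :=
  ∑ u, agentCost α s u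

/-- Pure Nash equilibrium: no agent can strictly decrease her cost by a unilateral change of her
strategy. -/
def IsNash {V : Type*} [Fintype V] [DecidableEq V] (α : ℝ) (s : Profile V) : Prop :=
  ∀ (u : V) (T : {S : Finset V // u ∉ S}),
    ¬ agentCost α (Function.update s u T) u < agentCost α s u

/-- The minimum social cost of a network on `n` agents (there are finitely many strategy vectors,
so the infimum is attained). -/
def optCost (n : ℕ) (α : ℝ) : ℝ≥0∞ :=
  ⨅ s : Profile (Fin n), socialCost α s

/-- The maximum social cost of a Nash equilibrium network on `n` agents (a supremum over a finite
set). -/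
def maxNashCost (n : ℕ) (α : ℝ) : ℝ≥0∞ :=
  ⨆ s : Profile (Fin n), ⨆ _ : IsNash α s, socialCost α s

/-- The price of anarchy of the game with `n` agents and edge price `α`. -/
def priceOfAnarchy (n : ℕ) (α : ℝ) : ℝ≥0∞ :=
  maxNashCost n α / optCost n α

end NetworkCreation

end

/-! Write D(v) for the sum of the distances from `v`. Nearly all equilibrium inequalities come from
one deviation: `v` gives up the edges to `X` and buys one to `u`. If shortest walks from `u` do not
need the lost edges, her new distances exceed those of `u` by at most one (`IsNash.swap_le`,
`IsNash.replace_le`). Two such inequalities in opposite directions cancel D(u) and D(v) and bound α.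

For n ≥ 7 equilibria are trees. An edge that is not a bridge lies on an isometric cycle
(`exists_isIsoCycle`). Deviations between opposite vertices show that the cycle is bought in one
direction (`IsNash.directed`), and a comparison of two cycles leaving the same agent shows that
nobody buys two non-bridges (`IsNash.eq_of_not_bridge`); this needs α > 4n - 13. Hence the rest of
the network hangs off the cycle in pieces, each attached at one vertex. The agent just before the
lightest piece would gain by moving her edge one vertex further, so there is no cycle
(`IsNash.bridge`).

In an equilibrium tree rooted at a median, subtree sizes at least halve per level from depth 2 on
(`IsNash.two_mul_closer_le`), so D grows by almost n per level. Since an extra edge to the median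
does not pay, the depth is at most α/n + 4 (`IsNash.dist_median_le`). Routing all distances through
the median and comparing with the lower bound (n-1)(α+2n-2) for every social cost gives the ratio.
For n ≤ 6 crude counts suffice. Existence: a star if α ≥ 1, the complete graph if α ≤ 1. -/

namespace NetworkCreation

/-! ### Walks of bounded length -/

/-- `b` can be reached from `a` in `H` by a walk of length at most `k`. -/
def Within {V : Type*} (H : SimpleGraph V) (k : ℕ) (a b : V) : Prop :=
  ∃ p : H.Walk a b, p.length ≤ k

section Within

variable {V : Type*} {H H' : SimpleGraph V} {a b c : V} {k l : ℕ}

theorem Within.refl (H : SimpleGraph V) (k : ℕ) (a : V) : Within H k a a :=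
  ⟨SimpleGraph.Walk.nil, Nat.zero_le _⟩

theorem Within.le (h : Within H k a b) (hkl : k ≤ l) : Within H l a b :=
  ⟨h.choose, h.choose_spec.trans hkl⟩

theorem Within.trans (h : Within H k a b) (h' : Within H l b c) : Within H (k + l) a c := by
  obtain ⟨p, hp⟩ := h
  obtain ⟨q, hq⟩ := h'
  exact ⟨p.append q, by rw [SimpleGraph.Walk.length_append]; omega⟩

theorem Within.symm (h : Within H k a b) : Within H k b a := by
  obtain ⟨p, hp⟩ := h
  exact ⟨p.reverse, by rwa [SimpleGraph.Walk.length_reverse]⟩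

theorem Within.mono (hH : H ≤ H') (h : Within H k a b) : Within H' k a b := by
  obtain ⟨p, hp⟩ := h
  exact ⟨p.mapLe hH, by simpa using hp⟩

theorem Within.of_adj (h : H.Adj a b) : Within H 1 a b :=
  ⟨h.toWalk, by simp⟩

theorem Within.reachable (h : Within H k a b) : H.Reachable a b := ⟨h.choose⟩

theorem Within.dist_le (h : Within H k a b) : H.dist a b ≤ k :=
  (H.dist_le h.choose).trans h.choose_spec

theorem Within.of_connected (hH : H.Connected) (a b : V) : Within H (H.dist a b) a b := by
  obtain ⟨p, hp⟩ := hH.exists_walk_length_eq_dist a b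
  exact ⟨p, hp.le⟩

/-- Sequences of adjacent vertices yield short walks. -/
theorem Within.of_chain (c : ℤ → V) (m : ℤ) (k : ℕ)
    (h : ∀ i : ℕ, i < k → H.Adj (c (m + i)) (c (m + i + 1))) :
    Within H k (c m) (c (m + k)) := by
  induction k with
  | zero => simpa using Within.refl H 0 (c m)
  | succ k ih =>
    have h1 := (ih fun i hi => h i (by omega)).trans (Within.of_adj (h k (by omega)))
    rwa [show m + ((k + 1 : ℕ) : ℤ) = m + k + 1 by push_cast; ring]

/-- If `H'` contains `H` except for the edge `vx`, a walk of `H` either can be replaced by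
one of `H'`, or splits at the edge `vx`. -/
theorem Within.cut_edge {v x : V}
    (hH : ∀ a b, H.Adj a b → H'.Adj a b ∨ (a = v ∧ b = x) ∨ (a = x ∧ b = v))
    (h : Within H k a b) :
    Within H' k a b ∨
      (∃ i j, Within H' i a v ∧ Within H' j x b ∧ i + j + 1 ≤ k) ∨
      (∃ i j, Within H' i a x ∧ Within H' j v b ∧ i + j + 1 ≤ k) := by
  obtain ⟨p, hp⟩ := h
  induction p generalizing k with
  | nil => exact Or.inl (Within.refl _ _ _)
  | @cons a a' b hadj p ih =>
    rw [SimpleGraph.Walk.length_cons] at hp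
    have hk : p.length ≤ k - 1 := by omega
    rcases hH _ _ hadj with h1 | ⟨rfl, rfl⟩ | ⟨rfl, rfl⟩
    · rcases ih hk with h2 | ⟨i, j, hi, hj, hij⟩ | ⟨i, j, hi, hj, hij⟩
      · exact Or.inl (((Within.of_adj h1).trans h2).le (by omega))
      · exact Or.inr (Or.inl ⟨1 + i, j, (Within.of_adj h1).trans hi, hj, by omega⟩)
      · exact Or.inr (Or.inr ⟨1 + i, j, (Within.of_adj h1).trans hi, hj, by omega⟩)
    · rcases ih hk with h2 | ⟨i, j, hi, hj, hij⟩ | ⟨i, j, hi, hj, hij⟩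
      · exact Or.inr (Or.inl ⟨0, k - 1, Within.refl _ _ _, h2, by omega⟩)
      · exact Or.inr (Or.inl ⟨0, j, Within.refl _ _ _, hj, by omega⟩)
      -- The walk crosses the edge and comes back to its start; dropping the excursion leaves a walk
      -- of `H'`.
      · exact Or.inl (hj.le (by omega))
    · rcases ih hk with h2 | ⟨i, j, hi, hj, hij⟩ | ⟨i, j, hi, hj, hij⟩
      · exact Or.inr (Or.inr ⟨0, k - 1, Within.refl _ _ _, h2, by omega⟩)
      · exact Or.inl (hj.le (by omega))
      · exact Or.inr (Or.inr ⟨0, j, Within.refl _ _ _, hj, by omega⟩)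

/-- A walk of `H` either survives in `H'` or visits `v`, if `H'` contains all edges of `H` that are
not incident to `v`. -/
theorem Within.avoid_or_through {v : V}
    (hH : ∀ a b, H.Adj a b → a ≠ v → b ≠ v → H'.Adj a b) (h : Within H k a b) :
    Within H' k a b ∨ ∃ i j, Within H i a v ∧ Within H j v b ∧ i + j ≤ k := by
  obtain ⟨p, hp⟩ := h
  induction p generalizing k with
  | nil => exact Or.inl (Within.refl _ _ _)
  | @cons a a' b hadj p ih =>
    rw [SimpleGraph.Walk.length_cons] at hp
    by_cases ha : a = v
    · subst ha
      exact Or.inr ⟨0, k, Within.refl _ _ _,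
        ⟨SimpleGraph.Walk.cons hadj p, by rw [SimpleGraph.Walk.length_cons]; exact hp⟩, by omega⟩
    by_cases ha' : a' = v
    · subst ha'
      exact Or.inr ⟨1, k - 1, Within.of_adj hadj, ⟨p, by omega⟩, by omega⟩
    rcases ih (k := k - 1) (by omega) with h2 | ⟨i, j, hi, hj, hij⟩
    · exact Or.inl (((Within.of_adj (hH _ _ hadj ha ha')).trans h2).le (by omega))
    · exact Or.inr ⟨1 + i, j, (Within.of_adj hadj).trans hi, hj, by omega⟩

end Within

/-! ### Removing edges at a vertex -/

/-- The graph `G` without the edges that join `v` to `X`. -/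
def cut {V : Type*} (G : SimpleGraph V) (v : V) (X : Finset V) : SimpleGraph V where
  Adj a b := G.Adj a b ∧ ¬ (a = v ∧ b ∈ X) ∧ ¬ (b = v ∧ a ∈ X)
  symm := ⟨fun _ _ h => ⟨h.1.symm, h.2.2, h.2.1⟩⟩
  loopless := ⟨fun _ h => G.loopless.irrefl _ h.1⟩

section Cut

variable {V : Type*} {G : SimpleGraph V} {v x : V} {X : Finset V}

theorem cut_le (G : SimpleGraph V) (v : V) (X : Finset V) : cut G v X ≤ G := fun _ _ h => h.1

theorem cut_singleton_comm (G : SimpleGraph V) (v x : V) : cut G v {x} = cut G x {v} := by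
  ext a b
  simp only [cut, Finset.mem_singleton]
  tauto

theorem cut_singleton_spec (G : SimpleGraph V) (v x : V) (a b : V) (h : G.Adj a b) :
    (cut G v {x}).Adj a b ∨ (a = v ∧ b = x) ∨ (a = x ∧ b = v) := by
  simp only [cut, Finset.mem_singleton]
  tauto

/-- If `x` is not closer to `w` than `v`, the shortest walks from `v` to `w` avoid the edge `vx`. -/
theorem within_cut_of_dist_le (hG : G.Connected) {w : V} (h : G.dist v w ≤ G.dist x w) :
    Within (cut G v {x}) (G.dist v w) v w := by
  rcases (Within.of_connected hG v w).cut_edge (cut_singleton_spec G v x) with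
    h1 | ⟨i, j, -, hj, hij⟩ | ⟨i, j, -, hj, hij⟩
  · exact h1
  · have := (hj.mono (cut_le _ _ _)).dist_le
    omega
  · exact hj.le (by omega)

/-- After the removal of edges from `v` to `X`, none of which is indispensable for shortest walks
from `u` (up to the walk from `u` to `v` itself), each vertex `w` is still at the same distance
from `u` or is reached by shortest walks through `v`. -/
theorem within_cut_or (hG : G.Connected) {u : V}
    (hX : ∀ x ∈ X, G.dist u x ≤ G.dist u v ∨
      ∃ z, z ≠ v ∧ G.Adj z x ∧ G.dist u z < G.dist u x) (w : V) :
    Within (cut G v X) (G.dist u w) u w ∨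
      ∃ k, Within (cut G v X) k v w ∧ k + G.dist u v ≤ G.dist u w := by
  induction hd : G.dist u w using Nat.strong_induction_on generalizing w with
  | _ d ih =>
    subst hd
    have extend : ∀ z, (cut G v X).Adj z w → G.dist u z < G.dist u w →
        Within (cut G v X) (G.dist u w) u w ∨
        ∃ k, Within (cut G v X) k v w ∧ k + G.dist u v ≤ G.dist u w := by
      intro z hz hlt
      rcases ih _ hlt z rfl with h | ⟨k, hk, hkl⟩
      · exact Or.inl ((h.trans (Within.of_adj hz)).le (by omega))
      · exact Or.inr ⟨k + 1, hk.trans (Within.of_adj hz), by omega⟩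
    by_cases hw : w = v
    · subst hw
      exact Or.inr ⟨0, Within.refl _ _ _, by omega⟩
    by_cases hu : u = w
    · subst hu
      exact Or.inl (Within.refl _ _ _)
    obtain ⟨p, hp⟩ := hG.exists_walk_length_eq_dist w u
    cases p with
    | nil => exact absurd rfl hu
    | @cons _ z _ hadj p =>
      rw [SimpleGraph.Walk.length_cons, G.dist_comm] at hp
      have hz : G.dist u z < G.dist u w := by
        have := G.dist_le p
        rw [G.dist_comm] at this
        omega
      by_cases hcut : (cut G v X).Adj z w
      · exact extend z hcut hz
      -- The last edge of the shortest walk was removed, so it led from `v` into `X`; `hX` then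
      -- supplies another neighbour of `w` that is closer to `u`.
      · have hzw : z = v ∧ w ∈ X := by
          by_contra hne
          exact hcut ⟨hadj.symm, hne, fun h => hw h.1⟩
        obtain ⟨rfl, hwX⟩ := hzw
        rcases hX w hwX with h | ⟨z', hz', hadj', hlt⟩
        · omega
        · exact extend z' ⟨hadj', fun h => hz' h.1, fun h => hw h.1⟩ hlt

end Cut

/-! ### Deviations in equilibrium -/

/-- The sum of the distances from `v`. -/
noncomputable def totalDist {V : Type*} [Fintype V] (G : SimpleGraph V) (v : V) : ℕ := ∑ w, G.dist v w

theorem connected_of_within {V : Type*} {G : SimpleGraph V} {v : V} {b : V → ℕ} (hb : ∀ w, Within G (b w) v w) :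
    G.Connected :=
  have : Nonempty V := ⟨v⟩
  ⟨fun x y => ((hb x).reachable.symm).trans (hb y).reachable⟩

theorem totalDist_le_of_within {V : Type*} [Fintype V] {G : SimpleGraph V} {v : V} {b : V → ℕ} (hb : ∀ w, Within G (b w) v w) :
    totalDist G v ≤ ∑ w, b w :=
  Finset.sum_le_sum fun w _ => (hb w).dist_le

theorem network_update_adj_of_mem {V : Type*} [DecidableEq V] {s : Profile V} {v : V}
    {T : {S : Finset V // v ∉ S}} {y : V} (hy : y ∈ T.1) :
    (network (Function.update s v T)).Adj v y := by
  left
  rwa [Function.update_self]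

/-- Distances after a deviation are bounded by walks in `cut`, which does not depend on what `v`
buys instead. -/
theorem cut_le_network_update {V : Type*} [DecidableEq V] {s : Profile V} {v : V}
    {T : {S : Finset V // v ∉ S}} {X : Finset V}
    (hT : (s v).1 \ X ⊆ T.1) : cut (network s) v X ≤ network (Function.update s v T) := by
  have key : ∀ a b, b ∈ (s a).1 → ¬ (a = v ∧ b ∈ X) →
      b ∈ (Function.update s v T a).1 := by
    intro a b hb hab
    by_cases ha : a = v
    · subst ha
      rw [Function.update_self]
      exact hT (Finset.mem_sdiff.2 ⟨hb, fun h => hab ⟨rfl, h⟩⟩)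
    · rwa [Function.update_of_ne ha]
  rintro a b ⟨h | h, h1, h2⟩
  · exact Or.inl (key a b h h1)
  · exact Or.inr (key b a h h2)

section Game

variable {V : Type*} [Fintype V] {α : ℝ} {s : Profile V} {v u : V}

theorem agentCost_of_connected (hα : 0 < α) (hG : (network s).Connected) (v : V) :
    agentCost α s v =
      ENNReal.ofReal (α * ((s v).1.card : ℝ) + (totalDist (network s) v : ℝ)) := by
  rw [agentCost, distCost, if_pos hG, ENNReal.ofReal_add (by positivity) (by positivity),
    ENNReal.ofReal_mul hα.le, ENNReal.ofReal_natCast, ENNReal.ofReal_natCast, totalDist]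
  push_cast
  rfl

theorem agentCost_of_not_connected (hG : ¬ (network s).Connected) (v : V) :
    agentCost α s v = ⊤ := by
  rw [agentCost, distCost, if_neg hG, add_top]

variable [DecidableEq V]

/-- In equilibrium, no deviation beats the current cost. -/
theorem IsNash.le_of_within (hs : IsNash α s) (hα : 0 < α) (hG : (network s).Connected)
    (T : {S : Finset V // v ∉ S}) (b : V → ℕ)
    (hb : ∀ w, Within (network (Function.update s v T)) (b w) v w) :
    α * ((s v).1.card : ℝ) + (totalDist (network s) v : ℝ) ≤
      α * (T.1.card : ℝ) + ∑ w, (b w : ℝ) := by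
  have h1 := not_lt.1 (hs v T)
  rw [agentCost_of_connected hα hG, agentCost_of_connected hα (connected_of_within hb),
    ENNReal.ofReal_le_ofReal_iff (by positivity), Function.update_self] at h1
  have h2 : (totalDist (network (Function.update s v T)) v : ℝ) ≤ ∑ w, (b w : ℝ) := by
    exact_mod_cast totalDist_le_of_within hb
  linarith

/-- Equilibrium networks are connected. -/
theorem IsNash.connected (hs : IsNash α s) (hα : 0 < α) [Nonempty V] : (network s).Connected := by
  by_contra hG
  obtain ⟨v⟩ := (inferInstance : Nonempty V)
  let T : {S : Finset V // v ∉ S} := ⟨Finset.univ.erase v, by simp⟩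
  have hb : ∀ w, Within (network (Function.update s v T)) 1 v w := by
    intro w
    by_cases hw : w = v
    · subst hw
      exact Within.refl _ _ _
    · exact Within.of_adj (network_update_adj_of_mem (by simp [T, hw]))
  refine hs v T ?_
  rw [agentCost_of_not_connected hG,
    agentCost_of_connected hα (connected_of_within (b := fun _ => 1) hb)]
  exact ENNReal.ofReal_lt_top

/-- In equilibrium, no edge is bought from both sides. -/
theorem IsNash.not_mem_of_mem (hs : IsNash α s) (hα : 0 < α) (hG : (network s).Connected)
    (h : v ∈ (s u).1) : u ∉ (s v).1 := by
  intro h'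
  let T : {S : Finset V // u ∉ S} := ⟨(s u).1.erase v, fun hu => (s u).2 (Finset.mem_of_mem_erase hu)⟩
  have hle : network s ≤ network (Function.update s u T) := by
    have huv : v ≠ u := fun e => (s u).2 (e ▸ h)
    have key : ∀ a b, b ∈ (s a).1 → (network (Function.update s u T)).Adj a b := by
      intro a b hb
      by_cases ha : a = u
      · subst ha
        by_cases hbv : b = v
        · subst hbv
          right
          rwa [Function.update_of_ne huv]
        · exact network_update_adj_of_mem (Finset.mem_erase.2 ⟨hbv, hb⟩)
      · left
        rwa [Function.update_of_ne ha]
    rintro a b (hb | hb)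
    · exact key a b hb
    · exact (key b a hb).symm
  have h1 := hs.le_of_within hα hG T (fun w => (network s).dist u w)
    fun w => (Within.of_connected hG u w).mono hle
  have h2 : T.1.card + 1 = (s u).1.card := Finset.card_erase_add_one h
  rw [← h2, totalDist] at h1
  push_cast at h1
  nlinarith

/-- In equilibrium, giving up the edges from `v` to `X` in favour of a single edge to `u` does not
pay off. -/
theorem IsNash.swap_le (hs : IsNash α s) (hα : 0 < α) (hG : (network s).Connected) (huv : u ≠ v)
    {X : Finset V} (hXs : X ⊆ (s v).1) (b : V → ℕ)
    (hb : ∀ w, (∃ k, Within (cut (network s) v X) k u w ∧ k + 1 ≤ b w) ∨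
      Within (cut (network s) v X) (b w) v w) :
    α * ((X.card : ℝ) - 1) + (totalDist (network s) v : ℝ) ≤ ∑ w, (b w : ℝ) := by
  let T : {S : Finset V // v ∉ S} := ⟨insert u ((s v).1 \ X), by
    simp only [Finset.mem_insert, Finset.mem_sdiff, not_or]
    exact ⟨huv.symm, fun h => (s v).2 h.1⟩⟩
  have hT : (s v).1 \ X ⊆ T.1 := Finset.subset_insert _ _
  have hcut := cut_le_network_update (T := T) hT
  have h1 := hs.le_of_within hα hG T b (by
    intro w
    rcases hb w with ⟨k, hk, hkb⟩ | h
    · exact ((Within.of_adj (network_update_adj_of_mem (Finset.mem_insert_self _ _))).trans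
        (hk.mono hcut)).le (by omega)
    · exact h.mono hcut)
  have h2 : T.1.card + X.card ≤ (s v).1.card + 1 := by
    have := Finset.card_insert_le u ((s v).1 \ X)
    have h3 := Finset.card_sdiff_add_card_eq_card hXs
    change (insert u ((s v).1 \ X)).card + _ ≤ _
    omega
  have h3 : (T.1.card : ℝ) + X.card ≤ (s v).1.card + 1 := by exact_mod_cast h2
  nlinarith

/-- In equilibrium, giving up the edge from `v` to `x` does not pay off. -/
theorem IsNash.drop_le (hs : IsNash α s) (hα : 0 < α) (hG : (network s).Connected)
    {x : V} (hx : x ∈ (s v).1) (b : V → ℕ)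
    (hb : ∀ w, Within (cut (network s) v {x}) (b w) v w) :
    α + (totalDist (network s) v : ℝ) ≤ ∑ w, (b w : ℝ) := by
  let T : {S : Finset V // v ∉ S} := ⟨(s v).1 \ {x}, fun h => (s v).2 (Finset.mem_sdiff.1 h).1⟩
  have h1 := hs.le_of_within hα hG T b fun w =>
    (hb w).mono (cut_le_network_update (T := T) subset_rfl)
  have h2 : T.1.card + 1 = (s v).1.card := by
    have := Finset.card_sdiff_add_card_eq_card (Finset.singleton_subset_iff.2 hx)
    rwa [Finset.card_singleton] at this
  rw [← h2] at h1
  push_cast at h1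
  linarith

/-- The vertices that, after `v` gave up the edges to `X`, are reached from `v` as fast as from `u`
through `v`. -/
def behind (G : SimpleGraph V) (u v : V) (X : Finset V) : Set V :=
  {w | ∃ k, Within (cut G v X) k v w ∧ k + G.dist u v ≤ G.dist u w}

open Classical in
/-- In equilibrium, `v` does not profit from replacing dispensable edges by an edge to `u`. -/
theorem IsNash.replace_le (hs : IsNash α s) (hα : 0 < α) (hG : (network s).Connected)
    (huv : u ≠ v) {X : Finset V} (hXs : X ⊆ (s v).1)
    (hX : ∀ x ∈ X, (network s).dist u x ≤ (network s).dist u v ∨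
      ∃ z, z ≠ v ∧ (network s).Adj z x ∧ (network s).dist u z < (network s).dist u x)
    (B : Finset V) (hB : ∀ w ∈ B, w ∈ behind (network s) u v X) :
    α * ((X.card : ℝ) - 1) + (totalDist (network s) v : ℝ) +
        ((network s).dist u v + 1) * (B.card : ℝ) ≤
      (totalDist (network s) u : ℝ) + (Fintype.card V : ℝ) := by
  -- Vertices of `B` are reached without the new edge, saving the way from `u` to `v`; all others
  -- are reached over `u` at one extra step, or at least as fast.
  have h1 := hs.swap_le hα hG huv hXs
    (fun w => if w ∈ B then (network s).dist u w - (network s).dist u v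
      else (network s).dist u w + 1) (by
    intro w
    by_cases hw : w ∈ B
    · obtain ⟨k, hk, hkl⟩ := hB w hw
      right
      rw [if_pos hw]
      exact hk.le (by omega)
    · rw [if_neg hw]
      rcases within_cut_or hG hX w with h | ⟨k, hk, hkl⟩
      · exact Or.inl ⟨_, h, le_rfl⟩
      · exact Or.inr (hk.le (by omega)))
  have h2 : ∀ w, (((if w ∈ B then (network s).dist u w - (network s).dist u v
      else (network s).dist u w + 1 : ℕ)) : ℝ) = (network s).dist u w + 1 -
        if w ∈ B then ((network s).dist u v + 1 : ℝ) else 0 := by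
    intro w
    by_cases hw : w ∈ B
    · obtain ⟨k, hk, hkl⟩ := hB w hw
      rw [if_pos hw, if_pos hw, Nat.cast_sub (by omega)]
      ring
    · rw [if_neg hw, if_neg hw]
      push_cast
      ring
  simp_rw [h2] at h1
  rw [Finset.sum_sub_distrib, Finset.sum_add_distrib, Finset.sum_ite_mem, Finset.univ_inter,
    Finset.sum_const, Finset.sum_const, Finset.card_univ] at h1
  simp only [nsmul_eq_mul, mul_one] at h1
  rw [totalDist.eq_1 (network s) u]
  push_cast
  linarith

end Game

/-! ### Isometric cycles -/

/-- `c` runs around a cycle of length `g` in `G` whose distances agree with those of `G`. -/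
structure IsIsoCycle {V : Type*} (G : SimpleGraph V) (g : ℕ) (c : ℤ → V) : Prop where
  three_le : 3 ≤ g
  dist_eq : ∀ (i : ℤ) (k : ℕ), k ≤ g → G.dist (c i) (c (i + k)) = min k (g - k)

namespace IsIsoCycle

variable {V : Type*} {G : SimpleGraph V} {g : ℕ} {c : ℤ → V}

theorem shift (h : IsIsoCycle G g c) (a : ℤ) : IsIsoCycle G g fun i => c (a + i) :=
  ⟨h.three_le, fun i k hk => by simpa only [add_assoc] using h.dist_eq (a + i) k hk⟩

theorem dist_of_eq_add (h : IsIsoCycle G g c) {i j : ℤ} (k : ℕ) (hj : j = i + k) (hk : k ≤ g) :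
    G.dist (c i) (c j) = min k (g - k) := hj ▸ h.dist_eq i k hk

theorem adj (h : IsIsoCycle G g c) (i : ℤ) : G.Adj (c i) (c (i + 1)) := by
  have h3 := h.three_le
  have := h.dist_of_eq_add (i := i) (j := i + 1) 1 (by simp) (by omega)
  rw [← SimpleGraph.dist_eq_one_iff_adj, this]
  omega

theorem ne_of_lt (h : IsIsoCycle G g c) {i j : ℤ} (hij : i < j) (hj : j < i + g) : c i ≠ c j := by
  intro he
  have := h.dist_of_eq_add (i := i) (j := j) (j - i).toNat (by omega) (by omega)
  rw [he, SimpleGraph.dist_self] at this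
  omega

theorem periodic (h : IsIsoCycle G g c) (hG : G.Connected) (i : ℤ) : c (i + g) = c i := by
  have := h.dist_eq i g le_rfl
  rw [Nat.sub_self, Nat.min_zero, hG.dist_eq_zero_iff] at this
  exact this.symm

theorem periodic_mul (h : IsIsoCycle G g c) (hG : G.Connected) (i q : ℤ) :
    c (i + g * q) = c i := by
  induction q using Int.induction_on with
  | zero => simp
  | succ q ih => rw [mul_add, mul_one, ← add_assoc, h.periodic hG, ih]
  | pred q ih => rw [← ih, mul_sub, mul_one, ← h.periodic hG]; congr 1; ring

end IsIsoCycle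

theorem within_getVert {V : Type*} {H : SimpleGraph V} {a b : V} (p : H.Walk a b) (i k : ℕ)
    (h : i + k ≤ p.length) : Within H k (p.getVert i) (p.getVert (i + k)) := by
  induction k with
  | zero => exact Within.refl _ _ _
  | succ k ih =>
    exact (ih (by omega)).trans (Within.of_adj (p.adj_getVert_succ (by omega)))

/-- An edge that is not a bridge lies on an isometric cycle. -/
theorem exists_isIsoCycle {V : Type*} {G : SimpleGraph V} (hG : G.Connected) {v x : V}
    (hvx : G.Adj v x) (h : (cut G v {x}).Reachable v x) :
    ∃ (g : ℕ) (c : ℤ → V), IsIsoCycle G g c ∧ c 0 = v ∧ c 1 = x := by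
  obtain ⟨H, hH⟩ : ∃ H, H = cut G v {x} := ⟨_, rfl⟩
  rw [← hH] at h
  -- The cycle is the edge `vx` closed by a shortest walk from `x` to `v` that avoids it.
  obtain ⟨p, hp⟩ := h.symm.exists_walk_length_eq_dist
  obtain ⟨m, hm⟩ : ∃ m, m = p.length := ⟨_, rfl⟩
  rw [← hm] at hp
  have hm2 : 2 ≤ m := by
    by_contra hlt
    have h01 : m = 0 ∨ m = 1 := by omega
    rcases h01 with h0 | h1
    · exact hvx.ne' (SimpleGraph.Walk.eq_of_length_eq_zero (hm ▸ h0))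
    · have hadj := SimpleGraph.Walk.adj_of_length_eq_one (hm ▸ h1)
      rw [hH] at hadj
      exact hadj.2.2 ⟨rfl, Finset.mem_singleton_self x⟩
  have hpos : ∀ a b, a ≤ b → b ≤ m →
      G.dist (p.getVert a) (p.getVert b) = min (b - a) (m + 1 - (b - a)) := by
    intro a b hab hb
    have hxa : Within H a x (p.getVert a) := by
      simpa using within_getVert p 0 a (by omega)
    have hav : Within H (m - a) (p.getVert a) v := by
      have := within_getVert p a (m - a) (by omega)
      rwa [Nat.add_sub_cancel' (by omega), hm, SimpleGraph.Walk.getVert_length, ← hm] at this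
    have hxb : Within H b x (p.getVert b) := by
      simpa using within_getVert p 0 b (by omega)
    have hbv : Within H (m - b) (p.getVert b) v := by
      have := within_getVert p b (m - b) (by omega)
      rwa [Nat.add_sub_cancel' (by omega), hm, SimpleGraph.Walk.getVert_length, ← hm] at this
    have hab' : Within H (b - a) (p.getVert a) (p.getVert b) := by
      have := within_getVert p a (b - a) (by omega)
      rwa [Nat.add_sub_cancel' (by omega)] at this
    have hle : H ≤ G := hH ▸ cut_le G v {x}
    have u1 := (hab'.mono hle).dist_le
    have u2 := (((hxa.symm.mono hle).trans (Within.of_adj hvx.symm)).trans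
      (hbv.symm.mono hle)).dist_le
    -- A shortcut that avoids `vx` would shorten `p`; if it uses `vx`, each of its two halves joined
    -- with a piece of `p` is again compared with distances in `H`.
    have l1 : m + 1 - (b - a) ≤ G.dist (p.getVert a) (p.getVert b) ∨
        b - a ≤ G.dist (p.getVert a) (p.getVert b) := by
      rcases (Within.of_connected hG (p.getVert a) (p.getVert b)).cut_edge
        (hH ▸ cut_singleton_spec G v x) with h1 | ⟨i, j, hi, hj, hij⟩ | ⟨i, j, hi, hj, hij⟩
      · have := ((hxa.trans h1).trans hbv).dist_le
        omega
      · have := (hxa.trans hi).dist_le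
        have := (hj.trans hbv).dist_le
        omega
      · have := (hi.symm.trans hav).dist_le
        have := (hxb.trans hj.symm).dist_le
        omega
    omega
  -- The shift by one puts the start `x` of `p` at index 1 and its end `v` at index 0.
  refine ⟨m + 1, fun i => p.getVert ((i - 1) % ((m + 1 : ℕ) : ℤ)).toNat, ⟨by omega, ?_⟩, ?_, ?_⟩
  · intro i k hk
    have hj0 := Int.emod_nonneg (i - 1) (b := ((m + 1 : ℕ) : ℤ)) (by omega)
    have hj1 := Int.emod_lt_of_pos (i - 1) (b := ((m + 1 : ℕ) : ℤ)) (by omega)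
    have hsum : (i + k - 1) % ((m + 1 : ℕ) : ℤ) =
        ((i - 1) % ((m + 1 : ℕ) : ℤ) + k) % ((m + 1 : ℕ) : ℤ) := by
      rw [Int.emod_add_emod]; congr 1; ring
    rw [hsum]
    generalize (i - 1) % ((m + 1 : ℕ) : ℤ) = j at hj0 hj1 ⊢
    by_cases hlt : j + k < ((m + 1 : ℕ) : ℤ)
    · rw [Int.emod_eq_of_lt (by omega) hlt, hpos _ _ (by omega) (by omega)]
      have : (j + k).toNat - j.toNat = k := by omega
      rw [this]
    · have : (j + k) % ((m + 1 : ℕ) : ℤ) = j + k - ((m + 1 : ℕ) : ℤ) := by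
        rw [← Int.sub_emod_right, Int.emod_eq_of_lt (by omega) (by omega)]
      rw [this, SimpleGraph.dist_comm, hpos _ _ (by omega) (by omega)]
      have : j.toNat - (j + k - ((m + 1 : ℕ) : ℤ)).toNat = m + 1 - k := by omega
      rw [this]
      omega
  · have : ((0 : ℤ) - 1) % ((m + 1 : ℕ) : ℤ) = m := by
      rw [← Int.add_emod_right, Int.emod_eq_of_lt (by omega) (by omega)]
      push_cast; ring
    dsimp only
    rw [this, Int.toNat_natCast, hm, SimpleGraph.Walk.getVert_length]
  · simp

/-! ### Isometric cycles in equilibrium -/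

section Directed

variable {V : Type*} [Fintype V] [DecidableEq V] {α : ℝ} {s : Profile V} {g : ℕ} {c : ℤ → V}

/-- There are no two agents such that one bought two edges and the other one edge that are
dispensable for shortest walks from the respective other agent. -/
theorem IsNash.not_critical_pair (hs : IsNash α s) (hα : 0 < α) (hG : (network s).Connected)
    (hn : 2 * (Fintype.card V : ℝ) - 4 < α) {u v x y z : V} (huv : u ≠ v) (hxy : x ≠ y)
    (hx : x ∈ (s v).1) (hy : y ∈ (s v).1) (hz : z ∈ (s u).1)
    (hx' : (network s).dist u x ≤ (network s).dist u v ∨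
      ∃ z, z ≠ v ∧ (network s).Adj z x ∧ (network s).dist u z < (network s).dist u x)
    (hy' : (network s).dist u y ≤ (network s).dist u v ∨
      ∃ z, z ≠ v ∧ (network s).Adj z y ∧ (network s).dist u z < (network s).dist u y)
    (hz' : (network s).dist v z ≤ (network s).dist v u ∨
      ∃ w, w ≠ u ∧ (network s).Adj w z ∧ (network s).dist v w < (network s).dist v z) :
    False := by
  have hl : 1 ≤ (network s).dist u v := hG.pos_dist_of_ne huv
  -- `v` trades both edges for one to `u`, and `u` trades hers for one to `v`. Adding the
  -- inequalities yields α + 2(d(u,v) + 1) ≤ 2n, hence α ≤ 2n - 4.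
  have h1 := hs.replace_le hα hG huv (X := {x, y})
    (by simp [Finset.insert_subset_iff, hx, hy])
    (by
      intro a ha
      rcases Finset.mem_insert.1 ha with rfl | ha
      · exact hx'
      · rw [Finset.mem_singleton.1 ha]
        exact hy') {v} (by
      intro w hw
      rw [Finset.mem_singleton.1 hw]
      exact ⟨0, Within.refl _ _ _, by omega⟩)
  have h2 := hs.replace_le hα hG huv.symm (X := {z}) (by simp [hz])
    (by
      intro a ha
      rw [Finset.mem_singleton.1 ha]
      exact hz') {u} (by
      intro w hw
      rw [Finset.mem_singleton.1 hw]
      exact ⟨0, Within.refl _ _ _, by omega⟩)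
  rw [Finset.card_pair hxy] at h1
  rw [SimpleGraph.dist_comm] at h2
  simp only [Finset.card_singleton] at h1 h2
  have hl' : (1 : ℝ) ≤ (network s).dist u v := by exact_mod_cast hl
  push_cast at h1 h2
  linarith

/-- No agent buys both her edges of an isometric cycle. -/
theorem IsNash.not_source (hs : IsNash α s) (hα : 0 < α) (hG : (network s).Connected)
    (hn : 2 * (Fintype.card V : ℝ) - 4 < α) (hc : IsIsoCycle (network s) g c) (i : ℤ)
    (h1 : c (i + 1) ∈ (s (c i)).1) (h2 : c (i - 1) ∈ (s (c i)).1) : False := by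
  have h3 := hc.three_le
  have hxy : c (i + 1) ≠ c (i - 1) := (hc.ne_of_lt (by omega) (by omega)).symm
  -- The partner for a critical pair is a buyer opposite `c i`: on an odd cycle the buyer of the
  -- opposite edge; on an even one the antipode, or a neighbour of it if the antipode buys neither
  -- of her cycle edges.
  obtain ⟨l, hl | hl⟩ := Nat.even_or_odd' g
  · have d0 : (network s).dist (c (i + l)) (c i) = l := by
      rw [SimpleGraph.dist_comm, hc.dist_of_eq_add l (by ring) (by omega)]; omega
    have d1 : (network s).dist (c (i + l)) (c (i + 1)) = l - 1 := by
      rw [SimpleGraph.dist_comm, hc.dist_of_eq_add (l - 1) (by omega) (by omega)]; omega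
    have d2 : (network s).dist (c (i + l)) (c (i - 1)) = l - 1 := by
      rw [SimpleGraph.dist_comm, hc.dist_of_eq_add (l + 1) (by push_cast; ring) (by omega)]; omega
    have hne : c (i + l) ≠ c i := (hc.ne_of_lt (by omega) (by omega)).symm
    have e1 : (network s).dist (c i) (c (i + l + 1)) = l - 1 := by
      rw [hc.dist_of_eq_add (l + 1) (by push_cast; ring) (by omega)]; omega
    have e2 : (network s).dist (c i) (c (i + l - 1)) = l - 1 := by
      rw [hc.dist_of_eq_add (l - 1) (by omega) (by omega)]; omega
    have d0' := d0
    rw [SimpleGraph.dist_comm] at d0'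
    by_cases h4 : c (i + l + 1) ∈ (s (c (i + l))).1
    · exact hs.not_critical_pair hα hG hn hne hxy h1 h2 h4 (Or.inl (by omega))
        (Or.inl (by omega)) (Or.inl (by omega))
    by_cases h5 : c (i + l - 1) ∈ (s (c (i + l))).1
    · exact hs.not_critical_pair hα hG hn hne hxy h1 h2 h5 (Or.inl (by omega))
        (Or.inl (by omega)) (Or.inl (by omega))
    have h6 : c (i + l) ∈ (s (c (i + l - 1))).1 := by
      have := hc.adj (i + l - 1)
      rw [sub_add_cancel] at this
      exact this.resolve_right h5
    have f0 : (network s).dist (c (i + l - 1)) (c i) = l - 1 := by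
      rw [SimpleGraph.dist_comm, e2]
    have f1 : (network s).dist (c (i + l - 1)) (c (i + 1)) = l - 2 := by
      rw [SimpleGraph.dist_comm, hc.dist_of_eq_add (l - 2) (by omega) (by omega)]; omega
    have f2 : (network s).dist (c (i + l - 1)) (c (i - 1)) = l := by
      rw [SimpleGraph.dist_comm, hc.dist_of_eq_add l (by omega) (by omega)]; omega
    have f3 : (network s).dist (c (i + l - 1)) (c (i - 2)) = l - 1 := by
      rw [SimpleGraph.dist_comm, hc.dist_of_eq_add (l + 1) (by push_cast; ring) (by omega)]; omega
    refine hs.not_critical_pair hα hG hn (u := c (i + l - 1)) ?_ hxy h1 h2 h6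
      -- Seen from `c (i + l - 1)`, the vertex `c (i - 1)` is farther than `c i`, but is also
      -- reached by a shortest walk through `c (i - 2)`; symmetrically for `c (i + l)` seen from `c
      -- i`.
      (Or.inl (by omega)) (Or.inr ⟨c (i - 2), ?_, ?_, by omega⟩)
      (Or.inr ⟨c (i + l + 1), ?_, ?_, by omega⟩)
    · exact (hc.ne_of_lt (by omega) (by omega)).symm
    · exact hc.ne_of_lt (by omega) (by omega)
    · have := hc.adj (i - 2)
      rwa [show i - 2 + 1 = i - 1 by ring] at this
    · exact (hc.ne_of_lt (by omega) (by omega)).symm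
    · exact (hc.adj (i + l)).symm
  · have e1 : (network s).dist (c i) (c (i + l)) = l := by
      rw [hc.dist_of_eq_add l (by ring) (by omega)]; omega
    have e2 : (network s).dist (c i) (c (i + l + 1)) = l := by
      rw [hc.dist_of_eq_add (l + 1) (by push_cast; ring) (by omega)]; omega
    have e1' := e1
    have e2' := e2
    rw [SimpleGraph.dist_comm] at e1' e2'
    rcases hc.adj (i + l) with h4 | h4
    · have d1 : (network s).dist (c (i + l)) (c (i + 1)) = l - 1 := by
        rw [SimpleGraph.dist_comm, hc.dist_of_eq_add (l - 1) (by omega) (by omega)]; omega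
      have d2 : (network s).dist (c (i + l)) (c (i - 1)) = l := by
        rw [SimpleGraph.dist_comm, hc.dist_of_eq_add (l + 1) (by push_cast; ring) (by omega)]
        omega
      refine hs.not_critical_pair hα hG hn ?_ hxy h1 h2 h4 (Or.inl (by omega))
        (Or.inl (by omega)) (Or.inl (by omega))
      exact (hc.ne_of_lt (by omega) (by omega)).symm
    · have d1 : (network s).dist (c (i + l + 1)) (c (i + 1)) = l := by
        rw [SimpleGraph.dist_comm, hc.dist_of_eq_add l (by omega) (by omega)]; omega
      have d2 : (network s).dist (c (i + l + 1)) (c (i - 1)) = l - 1 := by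
        rw [SimpleGraph.dist_comm, hc.dist_of_eq_add (l + 2) (by push_cast; ring) (by omega)]
        omega
      refine hs.not_critical_pair hα hG hn ?_ hxy h1 h2 h4 (Or.inl (by omega))
        (Or.inl (by omega)) (Or.inl (by omega))
      exact (hc.ne_of_lt (by omega) (by omega)).symm

/-- The edges of an isometric cycle are bought in one direction. -/
theorem IsNash.directed (hs : IsNash α s) (hα : 0 < α) (hG : (network s).Connected)
    (hn : 2 * (Fintype.card V : ℝ) - 4 < α) (hc : IsIsoCycle (network s) g c)
    (h0 : c 1 ∈ (s (c 0)).1) (i : ℤ) : c (i + 1) ∈ (s (c i)).1 := by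
  have step : ∀ j : ℤ, c (j + 1) ∈ (s (c j)).1 → c (j + 1 + 1) ∈ (s (c (j + 1))).1 := by
    intro j hj
    by_contra hcon
    -- One backward edge forces the next one backward, since nobody buys both; going around, this
    -- reaches the forward edge at `j`.
    have back : ∀ k : ℕ, c (j + 1 + k) ∈ (s (c (j + 1 + k + 1))).1 := by
      intro k
      induction k with
      | zero =>
        rw [Nat.cast_zero, add_zero]
        exact (hc.adj (j + 1)).resolve_left hcon
      | succ k ih =>
        rw [show j + 1 + ((k + 1 : ℕ) : ℤ) = j + 1 + k + 1 by push_cast; ring]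
        refine (hc.adj (j + 1 + k + 1)).resolve_left fun h => ?_
        refine hs.not_source hα hG hn hc (j + 1 + k + 1) h ?_
        rwa [add_sub_cancel_right]
    have h3 := hc.three_le
    have := back (g - 1)
    rw [show j + 1 + ((g - 1 : ℕ) : ℤ) = j + g by omega, show j + (g : ℤ) + 1 = j + 1 + g by ring,
      hc.periodic hG, hc.periodic hG] at this
    exact hs.not_mem_of_mem hα hG hj this
  have pos : ∀ k : ℕ, c (k + 1) ∈ (s (c k)).1 := by
    intro k
    induction k with
    | zero => simpa using h0
    | succ k ih => push_cast; exact step _ ih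
  have h3 := hc.three_le
  have hm0 := Int.emod_nonneg i (b := (g : ℤ)) (by omega)
  have := pos (i % g).toNat
  rw [Int.toNat_of_nonneg hm0] at this
  rw [← Int.emod_add_mul_ediv i g, add_right_comm, hc.periodic_mul hG, hc.periodic_mul hG]
  exact this

end Directed

/-! ### Agents buy at most one edge that is not a bridge -/

section OutDegree

variable {V : Type*} [Fintype V] [DecidableEq V] {α : ℝ} {s : Profile V} {g g' : ℕ}
  {c c' : ℤ → V}

/-- The remainder of an isometric cycle is a detour for each of its edges. -/
theorem IsNash.within_detour (hs : IsNash α s) (hα : 0 < α) (hG : (network s).Connected)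
    (hn : 2 * (Fintype.card V : ℝ) - 4 < α) (hc : IsIsoCycle (network s) g c)
    (h0 : c 1 ∈ (s (c 0)).1) {X : Finset V} (hX : X ⊆ (s (c 0)).1) :
    Within (cut (network s) (c 0) X) (g - 1) (c 1) (c 0) := by
  have h3 := hc.three_le
  have h := Within.of_chain (H := cut (network s) (c 0) X) c 1 (g - 1) (by
    intro i hi
    refine ⟨hc.adj _, fun h => ?_, fun h => ?_⟩
    · exact hc.ne_of_lt (i := 0) (j := 1 + i) (by omega) (by omega) h.1.symm
    · have h1 := hs.directed hα hG hn hc h0 (1 + i)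
      rw [h.1] at h1
      exact hs.not_mem_of_mem hα hG h1 (hX h.2))
  rwa [show (1 : ℤ) + ((g - 1 : ℕ) : ℤ) = 0 + g by omega, hc.periodic hG] at h

/-- Let `u` be opposite `v` on the longer cycle. Moving `c 1` to `u`, and the next cycle edge of `u`
to `v`, shows that the set `B` of vertices behind `v` is small. Then `v` can afford to give up both
edges for one to `u`, as only `B` suffers from detours around the shorter cycle. -/
theorem IsNash.not_two_cycles (hs : IsNash α s) (hα : 0 < α) (hG : (network s).Connected)
    (hV : 5 ≤ Fintype.card V) (hn : 4 * (Fintype.card V : ℝ) - 13 < α) {v : V}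
    (hc : IsIsoCycle (network s) g c) (hc' : IsIsoCycle (network s) g' c')
    (h0 : c 0 = v) (h0' : c' 0 = v) (h1 : c 1 ∈ (s v).1) (h1' : c' 1 ∈ (s v).1)
    (hne : c 1 ≠ c' 1) (hgg : g' ≤ g) : False := by
  classical
  have hV' : (5 : ℝ) ≤ Fintype.card V := by exact_mod_cast hV
  have hn2 : 2 * (Fintype.card V : ℝ) - 4 < α := by linarith
  have h3 := hc.three_le
  have h3' := hc'.three_le
  have hdir := hs.directed hα hG hn2 hc (by rwa [h0])
  obtain ⟨l, hl⟩ : ∃ l, l = g / 2 := ⟨_, rfl⟩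
  set G := network s with hGdef
  set u := c l with hu
  have huv : u ≠ v := by
    rw [← h0]
    exact (hc.ne_of_lt (by omega) (by omega)).symm
  have d0 : G.dist u v = l := by
    rw [SimpleGraph.dist_comm, ← h0, hu, hc.dist_of_eq_add l (by ring) (by omega)]
    omega
  have d1 : G.dist u (c 1) = l - 1 := by
    rw [SimpleGraph.dist_comm, hu, hc.dist_of_eq_add (l - 1) (by omega) (by omega)]
    omega
  have d2 : G.dist v (c (l + 1)) ≤ G.dist v u := by
    rw [G.dist_comm (u := v) (v := u), d0, ← h0, hc.dist_of_eq_add (l + 1) (by push_cast; ring)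
      (by omega)]
    omega
  have hX : ∀ x ∈ ({c 1} : Finset V), G.dist u x ≤ G.dist u v ∨
      ∃ z, z ≠ v ∧ G.Adj z x ∧ G.dist u z < G.dist u x := by
    intro x hx
    rw [Finset.mem_singleton.1 hx]
    exact Or.inl (by omega)
  obtain ⟨B, hB⟩ : ∃ B : Finset V, ∀ w, w ∈ B ↔ w ∈ behind G u v {c 1} :=
    ⟨Finset.univ.filter (· ∈ behind G u v {c 1}), fun w => by simp⟩
  have hvB : v ∈ B := (hB v).2 ⟨0, Within.refl _ _ _, by omega⟩
  have i1 := hs.replace_le hα hG huv (X := {c 1}) (by simpa using h1) hX B fun w hw => (hB w).1 hw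
  have i2 := hs.replace_le hα hG huv.symm (X := {c (l + 1)}) (by simpa using hdir l)
    (by
      intro a ha
      rw [Finset.mem_singleton.1 ha]
      exact Or.inl d2) {u} (by
      intro w hw
      rw [Finset.mem_singleton.1 hw]
      exact ⟨0, Within.refl _ _ _, by omega⟩)
  have hX2 : ({c 1, c' 1} : Finset V) ⊆ (s v).1 := by simp [Finset.insert_subset_iff, h1, h1']
  have detour : Within (cut G v {c 1, c' 1}) (g' - 1) (c' 1) v := by
    have := hs.within_detour hα hG hn2 hc' (by rwa [h0']) (X := {c 1, c' 1}) (by rwa [h0'])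
    rwa [h0'] at this
  -- A vertex of `B` was within d(u,w) - l of `v`. If that walk uses the edge to `c' 1`, the rest of
  -- `c'` replaces it, at g' - 2 ≤ 2l - 1 extra steps.
  have i3 := hs.swap_le hα hG huv hX2
    (fun w => if w = v then 0 else if w ∈ B then G.dist u w + (l - 1) else G.dist u w + 1) (by
    intro w
    by_cases hw : w = v
    · subst hw
      exact Or.inr (Within.refl _ _ _)
    by_cases hwB : w ∈ B
    · right
      rw [if_neg hw, if_pos hwB]
      obtain ⟨k, hk, hkl⟩ := (hB w).1 hwB
      rcases hk.cut_edge (H := cut G v {c 1}) (H' := cut G v {c 1, c' 1}) (v := v) (x := c' 1) (by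
          intro a b hab
          simp only [cut, Finset.mem_singleton, Finset.mem_insert] at hab ⊢
          tauto) with h | ⟨i, j, -, hj, hij⟩ | ⟨i, j, -, hj, hij⟩
      · exact h.le (by omega)
      · exact (detour.symm.trans hj).le (by omega)
      · exact hj.le (by omega)
    · left
      refine ⟨G.dist u w, ?_, by rw [if_neg hw, if_neg hwB]⟩
      rcases within_cut_or hG hX w with h | h
      · rcases h.avoid_or_through (H := cut G v {c 1}) (H' := cut G v {c 1, c' 1}) (v := v)
          (fun a b hab ha hb => ⟨hab.1, fun h => ha h.1, fun h => hb h.1⟩) with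
          h | ⟨i, j, hi, hj, hij⟩
        · exact h
        · refine absurd ((hB w).2 ⟨j, hj, ?_⟩) hwB
          have := (hi.mono (cut_le _ _ _)).dist_le
          omega
      · exact absurd ((hB w).2 h) hwB)
  have hsum : ∀ w, (((if w = v then 0 else if w ∈ B then G.dist u w + (l - 1)
      else G.dist u w + 1 : ℕ)) : ℝ) = G.dist u w + 1 + (if w ∈ B then (l - 2 : ℝ) else 0) -
        (if w = v then (2 * l - 1 : ℝ) else 0) := by
    intro w
    by_cases hw : w = v
    · subst hw
      rw [if_pos rfl, if_pos hvB, if_pos rfl, d0]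
      push_cast
      ring
    by_cases hwB : w ∈ B
    · rw [if_neg hw, if_pos hwB, if_pos hwB, if_neg hw, Nat.cast_add, Nat.cast_sub (by omega)]
      push_cast
      ring
    · rw [if_neg hw, if_neg hwB, if_neg hwB, if_neg hw]
      push_cast
      ring
  simp_rw [hsum] at i3
  rw [Finset.sum_sub_distrib, Finset.sum_add_distrib, Finset.sum_add_distrib, Finset.sum_ite_mem,
    Finset.univ_inter, Finset.sum_ite_eq' Finset.univ v, if_pos (Finset.mem_univ v),
    Finset.sum_const, Finset.sum_const, Finset.card_univ, Finset.card_pair hne] at i3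
  have hD : (∑ w, (G.dist u w : ℝ)) = (totalDist G u : ℝ) := by
    rw [totalDist]; push_cast; rfl
  rw [hD] at i3
  rw [G.dist_comm (u := v) (v := u)] at i2
  rw [d0] at i1 i2
  simp only [nsmul_eq_mul, mul_one, Finset.card_singleton] at i1 i2 i3
  push_cast at i1 i2 i3
  have hl1 : 1 ≤ l := by omega
  have hb1 : 1 ≤ B.card := Finset.card_pos.2 ⟨v, hvB⟩
  have hb1' : (1 : ℝ) ≤ B.card := by exact_mod_cast hb1
  generalize (B.card : ℝ) = b at *
  generalize (Fintype.card V : ℝ) = n at *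
  generalize (totalDist G u : ℝ) = du at *
  generalize (totalDist G v : ℝ) = dv at *
  -- The sum of `i1` and `i2`; `j2` is the sum of `i2` and `i3`.
  have j1 : ((l : ℝ) + 1) * (b + 1) ≤ 2 * n := by linarith
  have j2 : α ≤ 2 * n + b * (l - 2) - 3 * l := by linarith
  rcases Nat.lt_or_ge l 2 with hl2 | hl2
  · have : l = 1 := by omega
    subst this
    push_cast at j1 j2
    linarith
  · have hl2' : (0 : ℝ) ≤ (l : ℝ) - 2 := by
      have : (2 : ℝ) ≤ l := by exact_mod_cast hl2
      linarith
    generalize (l : ℝ) = m at *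
    have j3 := mul_le_mul_of_nonneg_left j1 hl2'
    have j4 : α * (m + 1) ≤ (2 * n + b * (m - 2) - 3 * m) * (m + 1) :=
      mul_le_mul_of_nonneg_right j2 (by linarith)
    have j5 : (4 * n - 13) * (m + 1) < α * (m + 1) :=
      mul_lt_mul_of_pos_right hn (by linarith)
    -- With t = m + 1 the contradiction is 4t² - 19t + 6n > 0, and 16 times the left side is (8t -
    -- 19)² + 96n - 361.
    nlinarith [sq_nonneg (8 * (m + 1) - 19)]

/-- Each agent buys at most one edge that is not a bridge. -/
theorem IsNash.eq_of_not_bridge (hs : IsNash α s) (hα : 0 < α) (hG : (network s).Connected)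
    (hV : 5 ≤ Fintype.card V) (hn : 4 * (Fintype.card V : ℝ) - 13 < α) {v x y : V}
    (hx : x ∈ (s v).1) (hy : y ∈ (s v).1)
    (hx' : (cut (network s) v {x}).Reachable v x)
    (hy' : (cut (network s) v {y}).Reachable v y) : x = y := by
  by_contra hne
  obtain ⟨g, c, hc, h0, rfl⟩ := exists_isIsoCycle hG (Or.inl hx) hx'
  obtain ⟨g', c', hc', h0', rfl⟩ := exists_isIsoCycle hG (Or.inl hy) hy'
  rcases le_total g' g with h | h
  · exact hs.not_two_cycles hα hG hV hn hc hc' h0 h0' hx hy hne h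
  · exact hs.not_two_cycles hα hG hV hn hc' hc h0' h0 hy hx (Ne.symm hne) h

end OutDegree

/-! ### Equilibrium networks are trees -/

/-- The graph `G` without the edges between consecutive vertices of `c`. -/
def withoutCycle {V : Type*} (G : SimpleGraph V) (c : ℤ → V) : SimpleGraph V where
  Adj a b := G.Adj a b ∧ ∀ i, ¬ (a = c i ∧ b = c (i + 1)) ∧ ¬ (b = c i ∧ a = c (i + 1))
  symm := ⟨fun _ _ h => ⟨h.1.symm, fun i => (h.2 i).symm⟩⟩
  loopless := ⟨fun _ h => G.loopless.irrefl _ h.1⟩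

section Attach

variable {V : Type*} {G : SimpleGraph V} {c : ℤ → V}

theorem exists_reachable_withoutCycle (hG : G.Connected) (w : V) :
    ∃ i, (withoutCycle G c).Reachable w (c i) := by
  obtain ⟨p⟩ := hG.preconnected w (c 0)
  generalize hz : c 0 = z at p
  induction p with
  | nil => exact ⟨0, by rw [hz]⟩
  | @cons a b _ hadj p ih =>
    by_cases h : ∃ i, (a = c i ∧ b = c (i + 1)) ∨ (b = c i ∧ a = c (i + 1))
    · obtain ⟨i, ⟨rfl, -⟩ | ⟨-, rfl⟩⟩ := h
      · exact ⟨i, SimpleGraph.Reachable.refl _⟩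
      · exact ⟨i + 1, SimpleGraph.Reachable.refl _⟩
    · obtain ⟨i, hi⟩ := ih hz
      have hab : (withoutCycle G c).Adj a b :=
        ⟨hadj, fun i => ⟨fun h' => h ⟨i, Or.inl h'⟩, fun h' => h ⟨i, Or.inr h'⟩⟩⟩
      exact ⟨i, hab.reachable.trans hi⟩

/-- If the cycle `c` is attached to each part of the rest of the graph at a single vertex, shortest
walks to the cycle pass through that vertex. -/
theorem dist_attach (hG : G.Connected) {A : V → V}
    (hA : ∀ a b, (withoutCycle G c).Adj a b → A a = A b) (hc : ∀ i, A (c i) = c i)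
    (i : ℤ) (w : V) : G.dist (c i) w = G.dist (c i) (A w) + G.dist (A w) w := by
  -- The length of the route through the attachment vertex drops by at most one along each edge.
  have key : ∀ a b : V, ∀ p : G.Walk a b,
      G.dist (c i) (A a) + G.dist (A a) a ≤ p.length + (G.dist (c i) (A b) + G.dist (A b) b) := by
    intro a b p
    induction p with
    | nil => omega
    | @cons a a' b hadj p ih =>
      rw [SimpleGraph.Walk.length_cons]
      have h1 : G.dist a a' = 1 := SimpleGraph.dist_eq_one_iff_adj.2 hadj
      by_cases h : ∃ i, (a = c i ∧ a' = c (i + 1)) ∨ (a' = c i ∧ a = c (i + 1))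
      · have haa : A a = a ∧ A a' = a' := by
          obtain ⟨i, ⟨rfl, rfl⟩ | ⟨rfl, rfl⟩⟩ := h <;> exact ⟨hc _, hc _⟩
        rw [haa.2, SimpleGraph.dist_self] at ih
        rw [haa.1, SimpleGraph.dist_self]
        have := hG.dist_triangle (u := c i) (v := a') (w := a)
        rw [G.dist_comm (u := a')] at this
        omega
      · have haa : A a = A a' :=
          hA a a' ⟨hadj, fun i => ⟨fun h' => h ⟨i, Or.inl h'⟩, fun h' => h ⟨i, Or.inr h'⟩⟩⟩
        rw [haa]
        have := hG.dist_triangle (u := A a') (v := a') (w := a)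
        rw [G.dist_comm (u := a')] at this
        omega
  obtain ⟨p, hp⟩ := hG.exists_walk_length_eq_dist w (c i)
  have h1 := key _ _ p
  rw [hc, SimpleGraph.dist_self, hp, G.dist_comm (u := w)] at h1
  have h2 := hG.dist_triangle (u := c i) (v := A w) (w := w)
  omega

end Attach

section Tree

variable {V : Type*} [Fintype V] [DecidableEq V] {α : ℝ} {s : Profile V} {g : ℕ} {c : ℤ → V}

/-- The edges of an isometric cycle are not bridges. -/
theorem IsNash.not_bridge_of_isIsoCycle (hs : IsNash α s) (hα : 0 < α)
    (hG : (network s).Connected) (hn : 2 * (Fintype.card V : ℝ) - 4 < α)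
    (hc : IsIsoCycle (network s) g c) (h0 : c 1 ∈ (s (c 0)).1) (m : ℤ) :
    (cut (network s) (c m) {c (m + 1)}).Reachable (c m) (c (m + 1)) := by
  have hdir : c (m + 1) ∈ (s (c (m + 0))).1 := by
    rw [add_zero]
    exact hs.directed hα hG hn hc h0 m
  have h := (hs.within_detour hα hG hn (hc.shift m) hdir
    (Finset.singleton_subset_iff.2 hdir)).reachable.symm
  rwa [add_zero] at h

/-- A vertex outside of an isometric cycle is attached to it by bridges only. -/
theorem IsNash.eq_of_reachable_withoutCycle (hs : IsNash α s) (hα : 0 < α)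
    (hG : (network s).Connected) (hV : 5 ≤ Fintype.card V)
    (hn : 4 * (Fintype.card V : ℝ) - 13 < α) (hc : IsIsoCycle (network s) g c)
    (h0 : c 1 ∈ (s (c 0)).1) {i j : ℤ}
    (h : (withoutCycle (network s) c).Reachable (c i) (c j)) : c i = c j := by
  have hV' : (5 : ℝ) ≤ Fintype.card V := by exact_mod_cast hV
  have hn2 : 2 * (Fintype.card V : ℝ) - 4 < α := by linarith
  have h3 := hc.three_le
  have hdir := hs.directed hα hG hn2 hc h0
  have hnb := hs.not_bridge_of_isIsoCycle hα hG hn2 hc h0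
  by_contra hne
  obtain ⟨p, hp⟩ := h.exists_isPath
  obtain ⟨z, hadj, p, rfl⟩ := SimpleGraph.Walk.exists_eq_cons_of_ne hne p
  · rw [SimpleGraph.Walk.cons_isPath_iff] at hp
    have hzj : (cut (network s) (c i) {z}).Reachable z (c j) := by
      refine ⟨p.transfer _ fun e he => ?_⟩
      induction e using Sym2.ind with
      | _ a b =>
        have hab := p.adj_of_mem_edges he
        refine ⟨hab.1, fun h => ?_, fun h => ?_⟩
        · exact hp.2 (h.1 ▸ p.fst_mem_support_of_mem_edges he)
        · exact hp.2 (h.1 ▸ p.snd_mem_support_of_mem_edges he)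
    have hcyc : ∀ m, (cut (network s) (c i) {z}).Reachable (c 0) (c m) := by
      have hstep : ∀ m, (cut (network s) (c i) {z}).Adj (c m) (c (m + 1)) := by
        intro m
        refine ⟨hc.adj m, fun h => ?_, fun h => ?_⟩
        · rw [Finset.mem_singleton] at h
          exact (hadj.2 m).1 ⟨h.1.symm, h.2.symm⟩
        · rw [Finset.mem_singleton] at h
          exact (hadj.2 m).2 ⟨h.2.symm, h.1.symm⟩
      intro m
      induction m using Int.induction_on with
      | zero => exact SimpleGraph.Reachable.refl _
      | succ m ih => exact ih.trans (hstep m).reachable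
      | pred m ih =>
        have := hstep (-(m : ℤ) - 1)
        rw [sub_add_cancel] at this
        exact ih.trans this.symm.reachable
    -- The outside path, closed by the cycle, bypasses its first edge, which is therefore not a
    -- bridge.
    have hiz : (cut (network s) (c i) {z}).Reachable (c i) z :=
      ((hcyc i).symm.trans (hcyc j)).trans hzj.symm
    rcases hadj.1 with h | h
    · have := hs.eq_of_not_bridge hα hG hV hn h (hdir i) hiz (hnb i)
      exact (hadj.2 i).1 ⟨rfl, this⟩
    · rw [cut_singleton_comm] at hiz
      obtain ⟨g', c', hc', rfl, h1'⟩ := exists_isIsoCycle hG (Or.inl h) hiz.symm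
      have h3' := hc'.three_le
      have h0' : c' 1 ∈ (s (c' 0)).1 := by rwa [h1']
      have hdir' := hs.directed hα hG hn2 hc' h0'
      have hnb' := hs.not_bridge_of_isIsoCycle hα hG hn2 hc' h0'
      -- From `c i` on, each agent's only non-bridge purchase is her edge of `c`, so `c'` must
      -- follow `c`. When it returns to `z`, the vertex `z` lies on `c` and its purchase is an edge
      -- of `c`.
      have hfol : ∀ k : ℕ, c' (1 + k) = c (i + k) := by
        intro k
        induction k with
        | zero => simpa using h1'
        | succ k ih =>
          have a1 := hdir' (1 + k)
          have a2 := hnb' (1 + k)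
          rw [ih] at a1 a2
          have := hs.eq_of_not_bridge hα hG hV hn a1 (hdir (i + k)) a2 (hnb (i + k))
          push_cast
          rw [← add_assoc, ← add_assoc]
          exact this
      have hz := hfol (g' - 1)
      rw [show (1 : ℤ) + ((g' - 1 : ℕ) : ℤ) = 0 + g' by omega, hc'.periodic hG] at hz
      have b1 := hdir (i + (g' - 1 : ℕ))
      have b2 := hnb (i + (g' - 1 : ℕ))
      rw [← hz] at b1 b2
      have := hs.eq_of_not_bridge hα hG hV hn h b1 hiz.symm b2
      exact (hadj.2 (i + (g' - 1 : ℕ))).2 ⟨hz, this⟩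

/-- Isometric cycles in equilibrium networks are long. -/
theorem IsNash.six_le (hs : IsNash α s) (hα : 0 < α) (hG : (network s).Connected)
    (hV : 7 ≤ Fintype.card V) (hn : 4 * (Fintype.card V : ℝ) - 13 < α)
    (hc : IsIsoCycle (network s) g c) (h0 : c 1 ∈ (s (c 0)).1) : 6 ≤ g := by
  by_contra hg
  have hV' : (7 : ℝ) ≤ Fintype.card V := by exact_mod_cast hV
  have hn2 : 2 * (Fintype.card V : ℝ) - 4 < α := by linarith
  have h3 := hc.three_le
  have hdetour := hs.within_detour hα hG hn2 hc h0 (X := {c 1}) (by simpa using h0)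
  have hne : c 0 ≠ c (-1) := (hc.ne_of_lt (by omega) (by omega)).symm
  have hne' : c (-1) ≠ c 1 := hc.ne_of_lt (by omega) (by omega)
  have hadj : (network s).Adj (c 0) (c (-1)) := by simpa using (hc.adj (-1)).symm
  -- A detour of at most 4 steps replaces one edge, and `c 0`, `c (-1)` are unaffected. So α ≤ 3(n -
  -- 2), which is at most 4n - 13 for n ≥ 7.
  have h1 := hs.drop_le hα hG h0 (fun w => (network s).dist (c 0) w +
      if w ∈ ({c 0, c (-1)} : Finset V) then 0 else 3) (by
    intro w
    by_cases hw : w ∈ ({c 0, c (-1)} : Finset V)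
    · rw [if_pos hw, add_zero]
      rcases Finset.mem_insert.1 hw with rfl | hw
      · exact Within.refl _ _ _
      · rw [Finset.mem_singleton.1 hw, SimpleGraph.dist_eq_one_iff_adj.2 hadj]
        refine Within.of_adj ⟨hadj, ?_, ?_⟩
        · simpa using hne'
        · exact fun h => hne h.1.symm
    · rw [if_neg hw]
      rcases (Within.of_connected hG (c 0) w).cut_edge (cut_singleton_spec _ (c 0) (c 1)) with
        h | ⟨i, j, -, hj, hij⟩ | ⟨i, j, -, hj, hij⟩
      · exact h.le (by omega)
      · exact (hdetour.symm.trans hj).le (by omega)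
      · exact hj.le (by omega))
  push_cast at h1
  rw [Finset.sum_add_distrib] at h1
  have h2 : ∑ w : V, (if w ∈ ({c 0, c (-1)} : Finset V) then (0 : ℝ) else 3) =
      3 * Fintype.card V - 6 := by
    have : ∀ w : V, (if w ∈ ({c 0, c (-1)} : Finset V) then (0 : ℝ) else 3) =
        3 - if w ∈ ({c 0, c (-1)} : Finset V) then (3 : ℝ) else 0 := by
      intro w; split_ifs <;> norm_num
    simp_rw [this]
    rw [Finset.sum_sub_distrib, Finset.sum_ite_mem, Finset.univ_inter, Finset.sum_const,
      Finset.sum_const, Finset.card_univ, Finset.card_pair hne]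
    simp only [nsmul_eq_mul]
    push_cast
    ring
  rw [h2, totalDist] at h1
  push_cast at h1
  linarith

/-- For high edge price, all edges of an equilibrium network are bridges. -/
theorem IsNash.bridge (hs : IsNash α s) (hα : 0 < α) (hG : (network s).Connected)
    (hV : 7 ≤ Fintype.card V) (hn : 4 * (Fintype.card V : ℝ) - 13 < α) {v x : V}
    (hvx : (network s).Adj v x) : ¬ (cut (network s) v {x}).Reachable v x := by
  classical
  wlog hx : x ∈ (s v).1 generalizing v x
  · intro h
    rw [cut_singleton_comm] at h
    exact this hvx.symm (hvx.resolve_left hx) h.symm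
  intro hreach
  obtain ⟨g, c, hc, rfl, rfl⟩ := exists_isIsoCycle hG hvx hreach
  have hV' : (7 : ℝ) ≤ Fintype.card V := by exact_mod_cast hV
  have hdir := hs.directed hα hG (by linarith) hc hx
  have hg := hs.six_le hα hG hV hn hc hx
  have huniq : ∀ i j, (withoutCycle (network s) c).Reachable (c i) (c j) → c i = c j :=
    fun i j h => hs.eq_of_reachable_withoutCycle hα hG (by omega) hn hc hx h
  choose idx hidx using fun w => exists_reachable_withoutCycle (c := c) hG w
  set A : V → V := fun w => c (idx w) with hAdef
  have hA : ∀ a b, (withoutCycle (network s) c).Adj a b → A a = A b := fun a b hab =>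
    huniq _ _ ((hidx a).symm.trans (hab.reachable.trans (hidx b)))
  have hAc : ∀ i, A (c i) = c i := fun i => huniq _ _ (hidx (c i)).symm
  have hdist := dist_attach hG hA hAc
  let W : ℤ → ℕ := fun i => (Finset.univ.filter fun w => A w = c i).card
  -- `W` counts the vertices of each attached piece; the lightest one is bypassed.
  obtain ⟨m, hm⟩ : ∃ m, ∀ j, W m ≤ W j := by
    obtain ⟨m, hm⟩ := WellFounded.has_min (measure W).wf Set.univ ⟨0, trivial⟩
    exact ⟨m, fun j => not_lt.1 (hm.2 j trivial)⟩
  have hinv : ∀ (w : V) (j : ℤ), ∃ k : ℕ, k < g ∧ A w = c (j + k) := by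
    intro w j
    have h0 := Int.emod_nonneg (idx w - j) (b := (g : ℤ)) (by omega)
    have h1 := Int.emod_lt_of_pos (idx w - j) (b := (g : ℤ)) (by omega)
    refine ⟨((idx w - j) % (g : ℤ)).toNat, by omega, ?_⟩
    rw [Int.toNat_of_nonneg h0, ← hc.periodic_mul hG _ ((idx w - j) / (g : ℤ)), add_assoc,
      Int.emod_add_mul_ediv, add_sub_cancel, hAdef]
  obtain ⟨i, rfl⟩ : ∃ i, m = i + 1 := ⟨m - 1, by ring⟩
  let r : V → ℕ := fun w => if (network s).dist (c (i + 1)) w < (network s).dist (c i) w then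
    (network s).dist (c (i + 2)) w + 1 else (network s).dist (c i) w
  have huv : c (i + 2) ≠ c i := (hc.ne_of_lt (by omega) (by omega)).symm
  have h1 := hs.swap_le hα hG huv (X := {c (i + 1)}) (by simpa using hdir i) r (by
    intro w
    by_cases hw : (network s).dist (c (i + 1)) w < (network s).dist (c i) w
    · simp only [r, if_pos hw]
      rcases within_cut_or hG (u := c (i + 2)) (v := c i) (X := {c (i + 1)}) (by
        intro x hx
        left
        rw [Finset.mem_singleton.1 hx, SimpleGraph.dist_comm, hc.dist_of_eq_add 1 (by ring)
          (by omega), SimpleGraph.dist_comm, hc.dist_of_eq_add 2 (by ring) (by omega)]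
        omega) w with h | ⟨k, hk, hkl⟩
      · exact Or.inl ⟨_, h, le_rfl⟩
      · exact Or.inr (hk.le (by omega))
    · simp only [r, if_neg hw]
      exact Or.inr (within_cut_of_dist_le hG (not_lt.1 hw)))
  -- Moving the edge of `c i` from `c (i + 1)` to `c (i + 2)` puts only the piece at `c (i + 1)` one
  -- step farther, and brings the next two one step closer; for the second of these, g ≥ 6 is
  -- needed.
  have h2 : ∀ w, r w + ((if A w = c (i + 2) then 1 else 0) + (if A w = c (i + 3) then 1 else 0)) ≤
      (network s).dist (c i) w + (if A w = c (i + 1) then 1 else 0) := by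
    intro w
    obtain ⟨k, hk, hAk⟩ := hinv w i
    have hiff : ∀ t : ℕ, t < g → (A w = c (i + t) ↔ k = t) := by
      intro t ht
      rw [hAk]
      refine ⟨fun h => ?_, fun h => by rw [h]⟩
      rcases Nat.lt_trichotomy k t with hlt | heq | hlt
      · exact absurd h (hc.ne_of_lt (by omega) (by omega))
      · exact heq
      · exact absurd h.symm (hc.ne_of_lt (by omega) (by omega))
    have n1 := hiff 1 (by omega)
    have n2 := hiff 2 (by omega)
    have n3 := hiff 3 (by omega)
    push_cast at n1 n2 n3
    have e0 := hdist i w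
    have e1 := hdist (i + 1) w
    have e2 := hdist (i + 2) w
    have d0 : (network s).dist (c i) (A w) = min k (g - k) := by
      rw [hAk, hc.dist_eq _ _ (by omega)]
    have d1 : (network s).dist (c (i + 1)) (A w) =
        if k = 0 then 1 else min (k - 1) (g - (k - 1)) := by
      rw [hAk]
      split_ifs with h
      · rw [SimpleGraph.dist_comm, hc.dist_of_eq_add 1 (by omega) (by omega)]; omega
      · rw [hc.dist_of_eq_add (k - 1) (by omega) (by omega)]
    have d2 : (network s).dist (c (i + 2)) (A w) =
        if k < 2 then 2 - k else min (k - 2) (g - (k - 2)) := by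
      rw [hAk]
      split_ifs with h
      · rw [SimpleGraph.dist_comm, hc.dist_of_eq_add (2 - k) (by omega) (by omega)]; omega
      · rw [hc.dist_of_eq_add (k - 2) (by omega) (by omega)]
    simp only [r, n1, n2, n3]
    rw [e0, e1, e2, d0, d1, d2]
    split_ifs <;> omega
  have h3 := Finset.sum_le_sum fun w (_ : w ∈ Finset.univ) => h2 w
  rw [Finset.sum_add_distrib, Finset.sum_add_distrib, Finset.sum_add_distrib] at h3
  simp only [Finset.sum_boole, Nat.cast_id] at h3
  have h4 : totalDist (network s) (c i) ≤ ∑ w, r w := by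
    have : ((totalDist (network s) (c i) : ℕ) : ℝ) ≤ ((∑ w, r w : ℕ) : ℝ) := by
      rw [Finset.card_singleton] at h1
      push_cast at h1 ⊢
      linarith
    exact_mod_cast this
  rw [totalDist] at h4
  have h5 := hm (i + 2)
  have h6 := hm (i + 3)
  have h7 : 1 ≤ W (i + 1) := Finset.card_pos.2 ⟨c (i + 1), by simp [hAc]⟩
  simp only [W] at h5 h6 h7
  omega

end Tree

/-! ### Distances in trees -/

section Bridges

variable {V : Type*} {G : SimpleGraph V}

/-- The two sides of a bridge have different distances to each vertex. -/
theorem dist_ne_of_bridge (hG : G.Connected) {v y : V}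
    (hb : ¬ (cut G v {y}).Reachable v y) (w : V) : G.dist v w ≠ G.dist y w := by
  intro h
  have h1 := (within_cut_of_dist_le hG h.le).reachable
  have h2 := (within_cut_of_dist_le hG h.ge).reachable
  rw [cut_singleton_comm] at h2
  exact hb (h1.trans h2.symm)

/-- Vertices on different sides of a bridge are connected through the bridge. -/
theorem dist_through_bridge (hG : G.Connected) {v y : V} (hvy : G.Adj v y)
    (hb : ¬ (cut G v {y}).Reachable v y) {c w : V} (hc : G.dist y c < G.dist v c)
    (hw : G.dist v w < G.dist y w) : G.dist c w = G.dist c y + 1 + G.dist v w := by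
  have h1 := (within_cut_of_dist_le hG hw.le).reachable
  have h2 := (within_cut_of_dist_le hG hc.le).reachable
  rw [cut_singleton_comm] at h2
  have hle := cut_le G v {y}
  have t1 := hG.dist_triangle (u := c) (v := y) (w := w)
  have t2 := hG.dist_triangle (u := y) (v := v) (w := w)
  rw [SimpleGraph.dist_eq_one_iff_adj.2 hvy.symm] at t2
  rcases (Within.of_connected hG c w).cut_edge (cut_singleton_spec G v y) with
    h | ⟨i, j, hi, hj, hij⟩ | ⟨i, j, hi, hj, hij⟩
  · exact absurd (h1.trans (h2.trans h.reachable).symm) hb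
  · exact absurd (h2.trans hi.reachable).symm hb
  · have := (hi.mono hle).dist_le
    have := (hj.mono hle).dist_le
    omega

theorem exists_parent (hG : G.Connected) {c v : V} (h : v ≠ c) :
    ∃ y, G.Adj v y ∧ G.dist c v = G.dist c y + 1 := by
  obtain ⟨p, hp⟩ := hG.exists_walk_length_eq_dist v c
  obtain ⟨y, hadj, q, rfl⟩ := SimpleGraph.Walk.exists_eq_cons_of_ne h p
  refine ⟨y, hadj, ?_⟩
  have h1 := G.dist_le q
  have h2 := hG.dist_triangle (u := v) (v := y) (w := c)
  rw [SimpleGraph.dist_eq_one_iff_adj.2 hadj] at h2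
  rw [SimpleGraph.Walk.length_cons] at hp
  rw [G.dist_comm (u := c), G.dist_comm (u := c)]
  omega

variable [Fintype V]

/-- The vertices that are closer to `v` than to `y`. -/
noncomputable def closer (G : SimpleGraph V) (v y : V) : Finset V :=
  Finset.univ.filter fun w => G.dist v w < G.dist y w

theorem mem_closer {v y w : V} : w ∈ closer G v y ↔ G.dist v w < G.dist y w := by
  simp [closer]

/-- Crossing a bridge changes every distance by exactly one, with the sign given by the side. -/
theorem totalDist_add_of_bridge (hG : G.Connected) {v y : V} (hvy : G.Adj v y)
    (hb : ¬ (cut G v {y}).Reachable v y) :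
    totalDist G v + 2 * (closer G v y).card = totalDist G y + Fintype.card V := by
  have h : ∀ w, G.dist v w + 2 * (if G.dist v w < G.dist y w then 1 else 0) = G.dist y w + 1 := by
    intro w
    have h1 := dist_ne_of_bridge hG hb w
    have t1 := hG.dist_triangle (u := y) (v := v) (w := w)
    have t2 := hG.dist_triangle (u := v) (v := y) (w := w)
    have h2 := SimpleGraph.dist_eq_one_iff_adj.2 hvy
    have h3 := SimpleGraph.dist_eq_one_iff_adj.2 hvy.symm
    split_ifs <;> omega
  have h4 := Finset.sum_congr rfl fun w (_ : w ∈ Finset.univ) => h w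
  rw [Finset.sum_add_distrib, Finset.sum_add_distrib, ← Finset.mul_sum] at h4
  simpa [totalDist, closer, Finset.card_univ] using h4

end Bridges

/-! ### Equilibrium trees -/

section EquilibriumTree

variable {V : Type*} [Fintype V] [DecidableEq V] {α : ℝ} {s : Profile V} {c v y : V}

/-- In an equilibrium tree, edges far from a median `c` are bought by the endpoint that is closer
to `c`. -/
theorem IsNash.mem_of_parent (hs : IsNash α s) (hα : 0 < α) (hG : (network s).Connected)
    (hb : ∀ {v x}, (network s).Adj v x → ¬ (cut (network s) v {x}).Reachable v x)
    (hc : ∀ w, totalDist (network s) c ≤ totalDist (network s) w)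
    (hvy : (network s).Adj v y) (hd : (network s).dist c v = (network s).dist c y + 1)
    (h2 : 2 ≤ (network s).dist c v) : v ∈ (s y).1 := by
  refine hvy.resolve_left fun hy => ?_
  have hcv : c ≠ v := by
    rintro rfl
    simp at h2
  have hcd : (network s).dist y c < (network s).dist v c := by
    rw [SimpleGraph.dist_comm, SimpleGraph.dist_comm (u := v)]
    omega
  -- If `v` bought the edge, she could redirect it to `c`. With T the subtree at `v`, this gives
  -- (d(c,v) + 1)|T| ≤ 2|T|, as D(c) ≤ D(y).
  have h3 := hs.replace_le hα hG hcv (X := {y}) (by simpa using hy) (by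
    intro x hx
    rw [Finset.mem_singleton.1 hx]
    left
    omega) (closer (network s) v y) (by
    intro w hw
    rw [mem_closer] at hw
    refine ⟨_, within_cut_of_dist_le hG hw.le, ?_⟩
    have := dist_through_bridge hG hvy (hb hvy) hcd hw
    omega)
  have h4 := totalDist_add_of_bridge hG hvy (hb hvy)
  have h5 := hc y
  have h6 : 1 ≤ (closer (network s) v y).card := Finset.card_pos.2 ⟨v, by
    rw [mem_closer, SimpleGraph.dist_self]
    exact hG.pos_dist_of_ne hvy.ne'⟩
  rw [Finset.card_singleton, Nat.cast_one, sub_self, mul_zero, zero_add] at h3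
  have h3' : totalDist (network s) v + ((network s).dist c v + 1) *
      (closer (network s) v y).card ≤ totalDist (network s) c + Fintype.card V := by
    exact_mod_cast h3
  nlinarith

/-- In an equilibrium tree, the sizes of subtrees far from a median are halved at each step. -/
theorem IsNash.two_mul_closer_le (hs : IsNash α s) (hα : 0 < α) (hG : (network s).Connected)
    (hb : ∀ {v x}, (network s).Adj v x → ¬ (cut (network s) v {x}).Reachable v x)
    (hc : ∀ w, totalDist (network s) c ≤ totalDist (network s) w)
    (hvy : (network s).Adj v y) (hd : (network s).dist c v = (network s).dist c y + 1)
    (h2 : 2 ≤ (network s).dist c v) {v' : V} (hv' : (network s).Adj v' v)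
    (hd' : (network s).dist c v' = (network s).dist c v + 1) :
    2 * (closer (network s) v' v).card ≤ (closer (network s) v y).card := by
  have hmem := hs.mem_of_parent hα hG hb hc hvy hd h2
  have hne : v' ≠ y := by
    rintro rfl
    omega
  have e1 := SimpleGraph.dist_eq_one_iff_adj.2 hv'
  have e2 := SimpleGraph.dist_eq_one_iff_adj.2 hvy
  have e3 : (network s).dist v' y = 2 := by
    have t1 := hG.dist_triangle (u := v') (v := v) (w := y)
    have t2 := hG.pos_dist_of_ne hne
    have t3 := dist_ne_of_bridge hG (hb hvy) v'
    rw [SimpleGraph.dist_comm, e1, SimpleGraph.dist_comm] at t3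
    omega
  -- The buyer `y` redirects her edge from `v` to the child `v'`; everything outside the subtree of
  -- `v` lies behind `y`.
  have h3 := hs.replace_le hα hG hne (X := {v}) (by simpa using hmem) (by
    intro x hx
    rw [Finset.mem_singleton.1 hx]
    left
    omega) (closer (network s) v y)ᶜ (by
    intro w hw
    rw [Finset.mem_compl, mem_closer, not_lt] at hw
    refine ⟨_, within_cut_of_dist_le hG hw, ?_⟩
    have hw' := lt_of_le_of_ne hw (dist_ne_of_bridge hG (hb hvy) w).symm
    have := dist_through_bridge hG hvy.symm (hb hvy.symm) (c := v') (w := w) (by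
      rw [SimpleGraph.dist_comm, SimpleGraph.dist_comm (u := y)]
      omega) hw'
    omega)
  have h4 := totalDist_add_of_bridge hG hvy (hb hvy)
  have h5 := totalDist_add_of_bridge hG hv' (hb hv')
  have h6 := Finset.card_add_card_compl (closer (network s) v y)
  rw [Finset.card_singleton, Nat.cast_one, sub_self, mul_zero, zero_add, e3] at h3
  have h3' : totalDist (network s) y + (2 + 1) *
      (closer (network s) v y)ᶜ.card ≤ totalDist (network s) v' + Fintype.card V := by
    exact_mod_cast h3
  omega

/-- In an equilibrium tree, vertices far from a median have large total distance. -/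
theorem IsNash.totalDist_ge (hs : IsNash α s) (hα : 0 < α) (hG : (network s).Connected)
    (hb : ∀ {v x}, (network s).Adj v x → ¬ (cut (network s) v {x}).Reachable v x)
    (hc : ∀ w, totalDist (network s) c ≤ totalDist (network s) w) (k : ℕ) :
    ∀ v y, (network s).Adj v y → (network s).dist c v = (network s).dist c y + 1 →
      (network s).dist c v = k + 2 →
      totalDist (network s) c + (k + 2) * Fintype.card V + 2 * (closer (network s) v y).card ≤
        totalDist (network s) v + 3 * Fintype.card V := by
  induction k with
  | zero =>
    intro v y hvy hd h2
    have hyc : (network s).Adj y c := by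
      rw [← SimpleGraph.dist_eq_one_iff_adj, SimpleGraph.dist_comm]
      omega
    have h3 := totalDist_add_of_bridge hG hvy (hb hvy)
    have h4 := totalDist_add_of_bridge hG hyc (hb hyc)
    -- Minimality of D(c) means that the branch at `y` contains at most half of the vertices.
    have h5 := hc y
    have h6 : (closer (network s) v y).card ≤ (closer (network s) y c).card := by
      refine Finset.card_le_card fun w hw => ?_
      rw [mem_closer] at hw ⊢
      have h7 := dist_through_bridge hG hvy (hb hvy) (c := c) (by
        rw [SimpleGraph.dist_comm, SimpleGraph.dist_comm (u := v)]
        omega) hw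
      have t1 := hG.dist_triangle (u := y) (v := v) (w := w)
      rw [SimpleGraph.dist_eq_one_iff_adj.2 hvy.symm] at t1
      omega
    omega
  | succ k ih =>
    intro v' v hv' hd' h2
    have hvc : v ≠ c := by
      rintro rfl
      rw [SimpleGraph.dist_self] at hd'
      omega
    obtain ⟨y, hvy, hd⟩ := exists_parent hG hvc
    have h3 := ih v y hvy hd (by omega)
    -- The step to `v'` adds n - 2|T'| to D, and halving lets the term 2|T| of the hypothesis pay
    -- for 4|T'|.
    have h4 := hs.two_mul_closer_le hα hG hb hc hvy hd (by omega) hv' hd'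
    have h5 := totalDist_add_of_bridge hG hv' (hb hv')
    have : (k + 1 + 2) * Fintype.card V = (k + 2) * Fintype.card V + Fintype.card V := by ring
    omega

/-- In an equilibrium tree, all vertices are close to a median. -/
theorem IsNash.dist_median_le (hs : IsNash α s) (hα : 0 < α) (hG : (network s).Connected)
    (hb : ∀ {v x}, (network s).Adj v x → ¬ (cut (network s) v {x}).Reachable v x)
    (hc : ∀ w, totalDist (network s) c ≤ totalDist (network s) w) (v : V) :
    ((network s).dist c v : ℝ) * Fintype.card V ≤ α + 4 * Fintype.card V := by
  by_cases hvc : c = v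
  · subst hvc
    rw [SimpleGraph.dist_self, Nat.cast_zero, zero_mul]
    positivity
  have h1 : totalDist (network s) c + (network s).dist c v * Fintype.card V ≤
      totalDist (network s) v + 3 * Fintype.card V := by
    obtain ⟨y, hvy, hd⟩ := exists_parent hG (Ne.symm hvc)
    have h0 := hc v
    rcases Nat.lt_or_ge ((network s).dist c v) 2 with h | h
    · have : (network s).dist c v = 1 := by omega
      rw [this]
      omega
    · obtain ⟨k, hk⟩ := Nat.exists_eq_add_of_le' h
      have := hs.totalDist_ge hα hG hb hc k v y hvy hd hk
      rw [hk]
      omega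
  -- With `X` empty this is the purchase of an additional edge to the median: D(v) ≤ D(c) + n + α.
  have h2 := hs.swap_le hα hG hvc (X := ∅) (Finset.empty_subset _)
    (fun w => (network s).dist c w + 1) (fun w => Or.inl ⟨_,
      (Within.of_connected hG c w).mono fun a b hab => ⟨hab, by simp, by simp⟩, le_rfl⟩)
  push_cast at h2
  rw [Finset.sum_add_distrib, Finset.sum_const, Finset.card_univ] at h2
  simp only [Finset.card_empty, nsmul_eq_mul, mul_one, Nat.cast_zero, zero_sub] at h2
  have h3 : (totalDist (network s) c : ℝ) + (network s).dist c v * Fintype.card V ≤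
      totalDist (network s) v + 3 * Fintype.card V := by exact_mod_cast h1
  have h4 : (∑ w, ((network s).dist c w : ℝ)) = totalDist (network s) c := by
    rw [totalDist]; push_cast; rfl
  rw [h4] at h2
  linarith

/-- Triangle inequality through `c`; omitting the pairs `w = v` turns the factor 2n into 2(n - 1).
-/
theorem sum_totalDist_le {G : SimpleGraph V} (hG : G.Connected) (c : V) :
    ∑ v, totalDist G v + 2 * totalDist G c ≤ 2 * Fintype.card V * totalDist G c := by
  have h : ∀ v, totalDist G v + 2 * G.dist c v ≤
      Fintype.card V * G.dist c v + totalDist G c := by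
    intro v
    have h1 : ∀ w, G.dist v w + (if w = v then 2 * G.dist c v else 0) ≤
        G.dist c v + G.dist c w := by
      intro w
      split_ifs with hw
      · subst hw
        rw [SimpleGraph.dist_self]
        omega
      · have := hG.dist_triangle (u := v) (v := c) (w := w)
        rw [G.dist_comm (u := v) (v := c)] at this
        omega
    have h2 := Finset.sum_le_sum fun w (_ : w ∈ Finset.univ) => h1 w
    rw [Finset.sum_add_distrib, Finset.sum_add_distrib, Finset.sum_ite_eq' Finset.univ v,
      if_pos (Finset.mem_univ v), Finset.sum_const, Finset.card_univ, smul_eq_mul] at h2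
    exact h2
  have h3 := Finset.sum_le_sum fun v (_ : v ∈ Finset.univ) => h v
  rw [Finset.sum_add_distrib, Finset.sum_add_distrib, ← Finset.mul_sum, ← Finset.mul_sum,
    Finset.sum_const, Finset.card_univ, smul_eq_mul] at h3
  have h4 : ∑ v, G.dist c v = totalDist G c := rfl
  rw [h4] at h3
  linarith

/-- The distance cost of an equilibrium tree. -/
theorem IsNash.sum_totalDist_le (hs : IsNash α s) (hα : 0 < α) (hG : (network s).Connected)
    (hb : ∀ {v x}, (network s).Adj v x → ¬ (cut (network s) v {x}).Reachable v x) :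
    ((∑ v, totalDist (network s) v : ℕ) : ℝ) * Fintype.card V ≤
      2 * ((Fintype.card V : ℝ) - 1) ^ 2 * (α + 4 * Fintype.card V) := by
  have := hG.nonempty
  obtain ⟨c, hc⟩ := Finite.exists_min fun v => totalDist (network s) v
  have h1 : ∀ v, ((network s).dist c v : ℝ) * Fintype.card V ≤
      α + 4 * Fintype.card V - if v = c then α + 4 * Fintype.card V else 0 := by
    intro v
    split_ifs with hv
    · subst hv
      simp
    · rw [sub_zero]
      exact hs.dist_median_le hα hG hb hc v
  have h2 := Finset.sum_le_sum fun v (_ : v ∈ Finset.univ) => h1 v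
  rw [← Finset.sum_mul, Finset.sum_sub_distrib, Finset.sum_ite_eq' Finset.univ c,
    if_pos (Finset.mem_univ c), Finset.sum_const, Finset.card_univ, nsmul_eq_mul] at h2
  have h3 : (∑ w, ((network s).dist c w : ℝ)) = totalDist (network s) c := by
    rw [totalDist]; push_cast; rfl
  rw [h3] at h2
  have h4 : ((∑ v, totalDist (network s) v : ℕ) : ℝ) + 2 * (totalDist (network s) c : ℝ) ≤
      2 * Fintype.card V * (totalDist (network s) c : ℝ) := by
    exact_mod_cast NetworkCreation.sum_totalDist_le hG c
  have h5 : (1 : ℝ) ≤ Fintype.card V := by exact_mod_cast Fintype.card_pos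
  generalize ((∑ v, totalDist (network s) v : ℕ) : ℝ) = S at *
  generalize (Fintype.card V : ℝ) = n at *
  generalize (totalDist (network s) c : ℝ) = D at *
  have h6 : S * n ≤ 2 * (n - 1) * (D * n) := by nlinarith
  have h7 : 2 * (n - 1) * (D * n) ≤ 2 * (n - 1) * (n * (α + 4 * n) - (α + 4 * n)) :=
    mul_le_mul_of_nonneg_left h2 (by linarith)
  linarith

end EquilibriumTree

/-! ### Social cost -/

/-- The number of edges that are bought in total. -/
def purchases {V : Type*} [Fintype V] (s : Profile V) : ℕ := ∑ u, (s u).1.card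

section SocialCost

variable {V : Type*} [Fintype V] {α : ℝ} {s : Profile V}

theorem socialCost_of_connected (hα : 0 < α) (hG : (network s).Connected) :
    socialCost α s = ENNReal.ofReal
      (α * (purchases s : ℝ) + ((∑ v, totalDist (network s) v : ℕ) : ℝ)) := by
  rw [socialCost]
  simp_rw [agentCost_of_connected hα hG]
  rw [← ENNReal.ofReal_sum_of_nonneg (fun _ _ => by positivity), Finset.sum_add_distrib,
    ← Finset.mul_sum, purchases]
  push_cast
  rfl

theorem socialCost_of_not_connected [Nonempty V] (hG : ¬ (network s).Connected) :
    socialCost α s = ⊤ := by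
  rw [socialCost, ENNReal.sum_eq_top]
  exact ⟨Classical.arbitrary V, Finset.mem_univ _, agentCost_of_not_connected hG _⟩

open Classical in
theorem sum_card_buyers (s : Profile V) :
    ∑ u, (Finset.univ.filter fun v => u ∈ (s v).1).card = purchases s := by
  simp_rw [Finset.card_filter]
  rw [Finset.sum_comm, purchases]
  simp

open Classical in
theorem neighborFinset_network [DecidableEq V] (s : Profile V) (u : V) :
    (network s).neighborFinset u = (s u).1 ∪ Finset.univ.filter fun v => u ∈ (s v).1 := by
  ext v
  rw [SimpleGraph.mem_neighborFinset, Finset.mem_union, Finset.mem_filter]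
  simp only [Finset.mem_univ, true_and]
  exact Iff.rfl

open Classical in
theorem degree_network_le [DecidableEq V] (s : Profile V) (u : V) :
    (network s).degree u ≤ (s u).1.card + (Finset.univ.filter fun v => u ∈ (s v).1).card := by
  rw [← SimpleGraph.card_neighborFinset_eq_degree, neighborFinset_network]
  exact Finset.card_union_le _ _

open Classical in
theorem sum_degree_le (s : Profile V) : ∑ u, (network s).degree u ≤ 2 * purchases s := by
  calc ∑ u, (network s).degree u
      ≤ ∑ u, ((s u).1.card + (Finset.univ.filter fun v => u ∈ (s v).1).card) :=
        Finset.sum_le_sum fun u _ => degree_network_le s u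
    _ = 2 * purchases s := by
        rw [Finset.sum_add_distrib, sum_card_buyers, two_mul, purchases]

open Classical in
theorem sum_degree_eq (hs : ∀ u v, v ∈ (s u).1 → u ∉ (s v).1) :
    ∑ u, (network s).degree u = 2 * purchases s := by
  have h : ∀ u, (network s).degree u =
      (s u).1.card + (Finset.univ.filter fun v => u ∈ (s v).1).card := by
    intro u
    rw [← SimpleGraph.card_neighborFinset_eq_degree, neighborFinset_network,
      Finset.card_union_of_disjoint]
    rw [Finset.disjoint_left]
    intro v hv hv'
    exact hs u v hv (Finset.mem_filter.1 hv').2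
  simp_rw [h]
  rw [Finset.sum_add_distrib, sum_card_buyers, two_mul, purchases]

-- Vertices other than `u` and its neighbours are at distance at least 2.
open Classical in
theorem totalDist_add_degree_ge {G : SimpleGraph V} (hG : G.Connected) (u : V) :
    2 * Fintype.card V ≤ totalDist G u + G.degree u + 2 := by
  have h : ∀ w, 2 ≤ G.dist u w + (if G.Adj u w then 1 else 0) + (if w = u then 2 else 0) := by
    intro w
    by_cases h1 : w = u
    · rw [if_pos h1]
      omega
    · have h2 := hG.pos_dist_of_ne (Ne.symm h1)
      by_cases h3 : G.Adj u w
      · rw [if_pos h3]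
        omega
      · have : G.dist u w ≠ 1 := fun h => h3 (SimpleGraph.dist_eq_one_iff_adj.1 h)
        omega
  have h2 := Finset.sum_le_sum fun w (_ : w ∈ Finset.univ) => h w
  rw [Finset.sum_add_distrib, Finset.sum_add_distrib, Finset.sum_ite_eq' Finset.univ u,
    if_pos (Finset.mem_univ u), Finset.sum_const, Finset.card_univ, Finset.sum_boole,
    smul_eq_mul, Nat.cast_id] at h2
  have h3 : (Finset.univ.filter fun w => G.Adj u w).card = G.degree u := by
    rw [← SimpleGraph.card_neighborFinset_eq_degree]
    congr 1
    ext w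
    simp
  rw [h3] at h2
  rw [totalDist]
  omega

open Classical in
theorem card_le_purchases_add_one (hG : (network s).Connected) :
    Fintype.card V ≤ purchases s + 1 := by
  have h1 := hG.card_vert_le_card_edgeSet_add_one
  rw [Nat.card_eq_fintype_card, Nat.card_eq_fintype_card, ← SimpleGraph.edgeFinset_card] at h1
  have h2 := (network s).sum_degrees_eq_twice_card_edges
  have h3 := sum_degree_le s
  omega

/-- A lower bound for the social cost. -/
theorem le_socialCost [Nonempty V] (hα : 2 ≤ α) :
    ENNReal.ofReal (((Fintype.card V : ℝ) - 1) * (α + 2 * Fintype.card V - 2)) ≤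
      socialCost α s := by
  classical
  by_cases hG : (network s).Connected
  · rw [socialCost_of_connected (by linarith) hG]
    refine ENNReal.ofReal_le_ofReal ?_
    have h1 := Finset.sum_le_sum fun u (_ : u ∈ Finset.univ) => totalDist_add_degree_ge hG u
    rw [Finset.sum_add_distrib, Finset.sum_add_distrib, Finset.sum_const, Finset.sum_const,
      Finset.card_univ, smul_eq_mul, smul_eq_mul] at h1
    have h2 := sum_degree_le s
    have h3 := card_le_purchases_add_one hG
    have h4 : Fintype.card V * (2 * Fintype.card V) ≤
        ∑ v, totalDist (network s) v + 2 * purchases s + Fintype.card V * 2 := by omega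
    have h5 : (Fintype.card V : ℝ) * (2 * Fintype.card V) ≤
        ((∑ v, totalDist (network s) v : ℕ) : ℝ) + 2 * purchases s + Fintype.card V * 2 := by
      exact_mod_cast h4
    have h6 : (Fintype.card V : ℝ) ≤ purchases s + 1 := by exact_mod_cast h3
    -- Each purchase lowers the bound on the distances by 2, so for α ≥ 2 the minimum is at n - 1
    -- purchases.
    nlinarith
  · rw [socialCost_of_not_connected hG]
    exact le_top

theorem card_le_totalDist_add_one {G : SimpleGraph V} (hG : G.Connected) (u : V) :
    Fintype.card V ≤ totalDist G u + 1 := by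
  classical
  have h : ∀ w, 1 ≤ G.dist u w + (if w = u then 1 else 0) := by
    intro w
    by_cases h1 : w = u
    · rw [if_pos h1]
      omega
    · have h2 := hG.pos_dist_of_ne (Ne.symm h1)
      omega
  have h2 := Finset.sum_le_sum fun w (_ : w ∈ Finset.univ) => h w
  rw [Finset.sum_add_distrib, Finset.sum_ite_eq' Finset.univ u, if_pos (Finset.mem_univ u),
    Finset.sum_const, Finset.card_univ, smul_eq_mul, mul_one] at h2
  exact h2

/-- A lower bound for the social cost that is valid for all edge prices. -/
theorem le_socialCost' [Nonempty V] (hα : 0 < α) :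
    ENNReal.ofReal (((Fintype.card V : ℝ) - 1) * (α + Fintype.card V)) ≤ socialCost α s := by
  by_cases hG : (network s).Connected
  · rw [socialCost_of_connected hα hG]
    refine ENNReal.ofReal_le_ofReal ?_
    have h1 := Finset.sum_le_sum fun u (_ : u ∈ Finset.univ) => card_le_totalDist_add_one hG u
    rw [Finset.sum_add_distrib, Finset.sum_const, Finset.sum_const, Finset.card_univ,
      smul_eq_mul, smul_eq_mul] at h1
    have h5 : (Fintype.card V : ℝ) * Fintype.card V ≤
        ((∑ v, totalDist (network s) v : ℕ) : ℝ) + Fintype.card V * 1 := by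
      exact_mod_cast h1
    have h6 : (Fintype.card V : ℝ) ≤ purchases s + 1 := by
      exact_mod_cast card_le_purchases_add_one hG
    nlinarith
  · rw [socialCost_of_not_connected hG]
    exact le_top

theorem totalDist_le_sq {G : SimpleGraph V} (hG : G.Connected) (u : V) :
    totalDist G u + (Fintype.card V - 1) ≤ Fintype.card V * (Fintype.card V - 1) := by
  classical
  have h : ∀ w, G.dist u w + (if w = u then Fintype.card V - 1 else 0) ≤ Fintype.card V - 1 := by
    intro w
    split_ifs with hw
    · rw [hw, SimpleGraph.dist_self]
      omega
    · obtain ⟨p, hp, hlen⟩ := hG.exists_path_of_dist u w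
      have := hp.length_lt
      omega
  have h2 := Finset.sum_le_sum fun w (_ : w ∈ Finset.univ) => h w
  rw [Finset.sum_add_distrib, Finset.sum_ite_eq' Finset.univ u, if_pos (Finset.mem_univ u),
    Finset.sum_const, Finset.card_univ, smul_eq_mul] at h2
  exact h2

variable [DecidableEq V]

/-- An upper bound for the social cost of equilibria. -/
theorem IsNash.socialCost_le (hs : IsNash α s) (hα : 0 < α) (hG : (network s).Connected) :
    socialCost α s ≤ ENNReal.ofReal (α * ((Fintype.card V : ℝ) * (Fintype.card V - 1) / 2) +
      Fintype.card V * ((Fintype.card V : ℝ) - 1) ^ 2) := by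
  classical
  have := hG.nonempty
  rw [socialCost_of_connected hα hG]
  refine ENNReal.ofReal_le_ofReal ?_
  have hpos : 1 ≤ Fintype.card V := Fintype.card_pos
  have h1 := Finset.sum_le_sum fun u (_ : u ∈ Finset.univ) => totalDist_le_sq hG u
  rw [Finset.sum_add_distrib, Finset.sum_const, Finset.sum_const, Finset.card_univ,
    smul_eq_mul, smul_eq_mul] at h1
  have h2 : 2 * purchases s ≤ Fintype.card V * (Fintype.card V - 1) := by
    rw [← sum_degree_eq fun u v h => hs.not_mem_of_mem hα hG h]
    calc ∑ u, (network s).degree u ≤ ∑ _u : V, (Fintype.card V - 1) :=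
          Finset.sum_le_sum fun u _ => Nat.le_sub_one_of_lt ((network s).degree_lt_card_verts u)
      _ = _ := by rw [Finset.sum_const, Finset.card_univ, smul_eq_mul]
  obtain ⟨m, hm⟩ := Nat.exists_eq_add_of_le' hpos
  rw [hm, Nat.add_sub_cancel] at h1 h2
  have h1' : ((∑ v, totalDist (network s) v : ℕ) : ℝ) + ((m : ℝ) + 1) * m ≤
      ((m : ℝ) + 1) * (((m : ℝ) + 1) * m) := by exact_mod_cast h1
  have h2' : 2 * (purchases s : ℝ) ≤ ((m : ℝ) + 1) * m := by exact_mod_cast h2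
  rw [hm]
  push_cast at h1' ⊢
  nlinarith

/-- Equilibrium networks all of whose edges are bridges have one edge less than vertices. -/
theorem IsNash.purchases_add_one (hs : IsNash α s) (hα : 0 < α) (hG : (network s).Connected)
    (hb : ∀ {v x}, (network s).Adj v x → ¬ (cut (network s) v {x}).Reachable v x) :
    purchases s + 1 = Fintype.card V := by
  classical
  have hac : (network s).IsAcyclic := by
    rw [SimpleGraph.isAcyclic_iff_forall_adj_isBridge]
    intro v w hvw
    rw [SimpleGraph.isBridge_iff]
    refine fun h => hb hvw (h.mono ?_)
    intro a b hab
    rw [SimpleGraph.deleteEdges_adj] at hab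
    refine ⟨hab.1, fun h' => hab.2 ?_, fun h' => hab.2 ?_⟩
    · rw [h'.1, Finset.mem_singleton.1 h'.2]
      rfl
    · rw [h'.1, Finset.mem_singleton.1 h'.2]
      exact Sym2.eq_swap
  have h1 := (SimpleGraph.IsTree.mk hG hac).card_edgeFinset
  have h2 := (network s).sum_degrees_eq_twice_card_edges
  have h3 := sum_degree_eq fun u v h => hs.not_mem_of_mem hα hG (u := u) (v := v) h
  omega

/-- For high edge price, the social cost of equilibria is bounded in terms of the optimum. -/
theorem IsNash.socialCost_le_mul (hs : IsNash α s) (hα : 0 < α) (hV : 2 ≤ Fintype.card V)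
    (hn : 4 * (Fintype.card V : ℝ) - 13 < α) (t : Profile V) :
    socialCost α s ≤ ENNReal.ofReal (3 + 2 * (Fintype.card V : ℝ) /
      (2 * (Fintype.card V : ℝ) + α)) * socialCost α t := by
  have : Nonempty V := Fintype.card_pos_iff.1 (by omega)
  have hG := hs.connected hα
  have hV' : (2 : ℝ) ≤ Fintype.card V := by exact_mod_cast hV
  rcases Nat.lt_or_ge 6 (Fintype.card V) with h | h
  · have hb : ∀ {v x}, (network s).Adj v x → ¬ (cut (network s) v {x}).Reachable v x :=
      fun hvx => hs.bridge hα hG h hn hvx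
    have hV7 : (7 : ℝ) ≤ Fintype.card V := by exact_mod_cast h
    refine le_trans ?_ (mul_le_mul_right (le_socialCost (s := t) (α := α) (by linarith)) _)
    rw [← ENNReal.ofReal_mul (by positivity), socialCost_of_connected hα hG]
    refine ENNReal.ofReal_le_ofReal ?_
    have h1 := hs.sum_totalDist_le hα hG hb
    have h2 : (purchases s : ℝ) = Fintype.card V - 1 := by
      have := hs.purchases_add_one hα hG hb
      rw [← this]
      push_cast
      ring
    rw [h2]
    generalize ((∑ v, totalDist (network s) v : ℕ) : ℝ) = S at *
    generalize (Fintype.card V : ℝ) = n at *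
    have hn0 : 0 < n * (2 * n + α) := by positivity
    refine le_of_mul_le_mul_right ?_ hn0
    have e1 : (3 + 2 * n / (2 * n + α)) * ((n - 1) * (α + 2 * n - 2)) * (n * (2 * n + α)) =
        (n - 1) * (n * (3 * α + 8 * n) * (α + 2 * n - 2)) := by
      field_simp
      ring
    rw [e1]
    have e2 : (α * (n - 1) + S) * (n * (2 * n + α)) =
        (n - 1) * (α * n * (2 * n + α)) + (S * n) * (2 * n + α) := by ring
    rw [e2]
    have h3 := mul_le_mul_of_nonneg_right h1 (show 0 ≤ 2 * n + α by positivity)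
    -- This is exactly the difference of the two sides once `h3` is inserted.
    have h4 : 0 ≤ (n - 1) * (2 * α ^ 2 + 6 * α * n) :=
      mul_nonneg (by linarith) (by positivity)
    nlinarith
  · have h3 : ENNReal.ofReal 3 ≤ ENNReal.ofReal (3 + 2 * (Fintype.card V : ℝ) /
        (2 * (Fintype.card V : ℝ) + α)) :=
      ENNReal.ofReal_le_ofReal (le_add_of_nonneg_right (by positivity))
    refine le_trans (hs.socialCost_le hα hG) (le_trans ?_ (mul_le_mul_left h3 _))
    have h6 : (Fintype.card V : ℝ) ≤ 6 := by exact_mod_cast h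
    -- For n ≤ 6 at most n(n-1)/2 ≤ 3(n-1) edges are bought. If n ≥ 5, then α > 7 and the bound for
    -- α ≥ 2 applies; for n ≤ 4 the price may be smaller, but the weaker bound suffices.
    rcases Nat.lt_or_ge 4 (Fintype.card V) with h4 | h4
    · have h5 : (5 : ℝ) ≤ Fintype.card V := by exact_mod_cast h4
      refine le_trans ?_ (mul_le_mul_right (le_socialCost (s := t) (α := α) (by linarith)) _)
      rw [← ENNReal.ofReal_mul (by norm_num)]
      refine ENNReal.ofReal_le_ofReal ?_
      generalize (Fintype.card V : ℝ) = n at *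
      have h7 : 0 ≤ (n - 1) * (6 - n) := mul_nonneg (by linarith) (by linarith)
      have h8 := mul_nonneg h7 hα.le
      have h9 := mul_nonneg h7 (show 0 ≤ n - 1 by linarith)
      nlinarith
    · have h5 : (Fintype.card V : ℝ) ≤ 4 := by exact_mod_cast h4
      refine le_trans ?_ (mul_le_mul_right (le_socialCost' (s := t) (α := α) hα) _)
      rw [← ENNReal.ofReal_mul (by norm_num)]
      refine ENNReal.ofReal_le_ofReal ?_
      generalize (Fintype.card V : ℝ) = n at *
      have h7 : 0 ≤ (n - 1) * (4 - n) := mul_nonneg (by linarith) (by linarith)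
      have h8 := mul_nonneg h7 hα.le
      have h9 := mul_nonneg h7 (show 0 ≤ n by linarith)
      have h10 := mul_nonneg (show 0 ≤ n - 1 by linarith) hα.le
      nlinarith

end SocialCost

/-! ### Existence of equilibria -/

section Existence

variable {V : Type*} [Fintype V] [DecidableEq V] {α : ℝ} {s : Profile V}

-- After any deviation the neighbours of `u` are in `T` or had bought an edge to `u` before, so each
-- edge she buys saves at most one unit of distance.
open Classical in
theorem totalDist_update_ge {u : V} {T : {S : Finset V // u ∉ S}}
    (hN : (network (Function.update s u T)).Connected) :
    2 * Fintype.card V ≤ totalDist (network (Function.update s u T)) u + T.1.card +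
      (Finset.univ.filter fun v => u ∈ (s v).1).card + 2 := by
  have h1 := totalDist_add_degree_ge hN u
  have h2 := degree_network_le (Function.update s u T) u
  rw [Function.update_self] at h2
  have h3 := h2.trans (Nat.add_le_add_left (Finset.card_le_card
    (t := Finset.univ.filter fun v => u ∈ (s v).1) fun v hv => by
      rw [Finset.mem_filter] at hv ⊢
      by_cases hvu : v = u
      · subst hvu
        exact absurd hv.2 (Function.update s v T v).2
      · rwa [Function.update_of_ne hvu] at hv) _)
  omega

/-- To check that a profile with connected network is an equilibrium, it suffices to consider
deviations to connected networks. -/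
theorem isNash_of_forall_le (hα : 0 < α) (hs : (network s).Connected)
    (h : ∀ (u : V) (T : {S : Finset V // u ∉ S}),
      (network (Function.update s u T)).Connected →
        α * ((s u).1.card : ℝ) + (totalDist (network s) u : ℝ) ≤
          α * (T.1.card : ℝ) + (totalDist (network (Function.update s u T)) u : ℝ)) :
    IsNash α s := by
  intro u T
  rw [not_lt]
  by_cases hN : (network (Function.update s u T)).Connected
  · rw [agentCost_of_connected hα hs, agentCost_of_connected hα hN, Function.update_self]
    exact ENNReal.ofReal_le_ofReal (h u T hN)
  · rw [agentCost_of_not_connected hN]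
    exact le_top

/-- The star whose center `z` buys all edges. -/
def star (z : V) : Profile V := fun u =>
  ⟨if u = z then Finset.univ.erase u else ∅, by split_ifs <;> simp⟩

theorem mem_star {z u v : V} : v ∈ (star z u).1 ↔ u = z ∧ v ≠ z := by
  unfold star
  by_cases h : u = z
  · subst h
    simp
  · simp [h]

/-- The star is an equilibrium for edge prices at least `1`. -/
theorem isNash_star (hα : 1 ≤ α) (z : V) : IsNash α (star z) := by
  classical
  have hz : ∀ w, w ≠ z → (network (star z)).Adj z w := fun w hw => Or.inl (mem_star.2 ⟨rfl, hw⟩)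
  have hzw : ∀ w, Within (network (star z)) 1 z w := by
    intro w
    by_cases hw : w = z
    · rw [hw]
      exact Within.refl _ _ _
    · exact Within.of_adj (hz w hw)
  refine isNash_of_forall_le (by linarith) (connected_of_within hzw) fun u T hN => ?_
  by_cases huz : u = z
  · subst huz
    -- Nobody else buys edges, so the center must keep all of them for connectivity.
    have hT : T = star u u := by
      refine Subtype.ext (Finset.ext fun w => ?_)
      rw [mem_star]
      refine ⟨fun hw => ⟨rfl, fun h => T.2 (h ▸ hw)⟩, fun hw => ?_⟩
      obtain ⟨x, hx, -⟩ := exists_parent hN hw.2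
      rcases hx with hx | hx
      · rw [Function.update_of_ne hw.2, mem_star] at hx
        exact absurd hx.1 hw.2
      · by_cases hxu : x = u
        · subst hxu
          rwa [Function.update_self] at hx
        · rw [Function.update_of_ne hxu, mem_star] at hx
          exact absurd hx.1 hxu
    rw [hT, Function.update_eq_self]
  · have h1 := totalDist_update_ge hN
    have h2 : (Finset.univ.filter fun v => u ∈ (star z v).1).card ≤ 1 := by
      rw [Finset.card_le_one]
      intro a ha b hb
      rw [Finset.mem_filter, mem_star] at ha hb
      rw [ha.2.1, hb.2.1]
    have h3 : (star z u).1.card = 0 := by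
      rw [Finset.card_eq_zero, Finset.eq_empty_iff_forall_notMem]
      exact fun w hw => huz (mem_star.1 hw).1
    have h4 : totalDist (network (star z)) u + 3 ≤ 2 * Fintype.card V := by
      have h5 : ∀ w, (network (star z)).dist u w + ((if w = u then 2 else 0) +
          (if w = z then 1 else 0)) ≤ 2 := by
        intro w
        by_cases hwu : w = u
        · subst hwu
          rw [SimpleGraph.dist_self, if_neg huz]
          simp
        · by_cases hwz : w = z
          · subst hwz
            have := (hzw u).symm.dist_le
            rw [if_neg hwu, if_pos rfl]
            omega
          · have := ((hzw u).symm.trans (hzw w)).dist_le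
            rw [if_neg hwu, if_neg hwz]
            omega
      have h6 := Finset.sum_le_sum fun w (_ : w ∈ Finset.univ) => h5 w
      rw [Finset.sum_add_distrib, Finset.sum_add_distrib, Finset.sum_ite_eq' Finset.univ u,
        Finset.sum_ite_eq' Finset.univ z, if_pos (Finset.mem_univ u), if_pos (Finset.mem_univ z),
        Finset.sum_const, Finset.card_univ, smul_eq_mul] at h6
      rw [totalDist]
      omega
    have h7 : totalDist (network (star z)) u ≤
        T.1.card + totalDist (network (Function.update (star z) u T)) u := by omega
    have h8 : (totalDist (network (star z)) u : ℝ) ≤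
        T.1.card + totalDist (network (Function.update (star z) u T)) u := by exact_mod_cast h7
    rw [h3]
    have h9 : (0 : ℝ) ≤ T.1.card := Nat.cast_nonneg _
    push_cast
    nlinarith

end Existence

/-- The complete graph, in which each agent buys the edges to all later agents. -/
def complete (n : ℕ) : Profile (Fin n) := fun u => ⟨Finset.Ioi u, by simp⟩

/-- The complete graph is an equilibrium for edge prices at most `1`. -/
theorem isNash_complete {n : ℕ} (hn : 0 < n) {α : ℝ} (hα : 0 < α) (hα1 : α ≤ 1) :
    IsNash α (complete n) := by
  classical
  have hw : ∀ u w, Within (network (complete n)) (if w = u then 0 else 1) u w := by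
    intro u w
    split_ifs with h
    · rw [h]
      exact Within.refl _ _ _
    · refine Within.of_adj ?_
      rcases lt_or_gt_of_ne h with h | h
      · exact Or.inr (Finset.mem_Ioi.2 h)
      · exact Or.inl (Finset.mem_Ioi.2 h)
  refine isNash_of_forall_le hα (connected_of_within (hw ⟨0, hn⟩)) fun u T hN => ?_
  have h1 := totalDist_update_ge hN
  have h2 := card_le_totalDist_add_one hN u
  have h3 : (Finset.univ.filter fun v => u ∈ (complete n v).1).card = u := by
    rw [← Fin.card_Iio]
    congr 1
    ext v
    simp [complete]
  have h4 : (complete n u).1.card = n - 1 - u := Fin.card_Ioi u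
  have h5 : totalDist (network (complete n)) u + 1 ≤ n := by
    have h6 : ∀ w, (network (complete n)).dist u w + (if w = u then 1 else 0) ≤ 1 := by
      intro w
      have := (hw u w).dist_le
      split_ifs at this ⊢ <;> omega
    have h7 := Finset.sum_le_sum fun w (_ : w ∈ Finset.univ) => h6 w
    rw [Finset.sum_add_distrib, Finset.sum_ite_eq' Finset.univ u, if_pos (Finset.mem_univ u),
      Finset.sum_const, Finset.card_univ, Fintype.card_fin, smul_eq_mul, mul_one] at h7
    exact h7
  rw [Fintype.card_fin] at h1 h2
  have hu := u.2
  have a1 : (totalDist (network (complete n)) u : ℝ) ≤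
      totalDist (network (Function.update (complete n) u T)) u := by
    exact_mod_cast (by omega : totalDist (network (complete n)) u ≤
      totalDist (network (Function.update (complete n) u T)) u)
  have a2 : (totalDist (network (complete n)) u : ℝ) + ((complete n u).1.card : ℝ) ≤
      totalDist (network (Function.update (complete n) u T)) u + T.1.card := by
    exact_mod_cast (by omega : totalDist (network (complete n)) u + (complete n u).1.card ≤
      totalDist (network (Function.update (complete n) u T)) u + T.1.card)
  -- Combine `a1` with weight 1 - α and `a2` with weight α.
  nlinarith

end NetworkCreation

theorem mainTheorem7 (n : ℕ) (hn : 2 ≤ n) (α : ℝ) (hpos : 0 < α)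
    (hα : 4 * (n : ℝ) - 13 < α) :
    (∃ s : NetworkCreation.Profile (Fin n), NetworkCreation.IsNash α s) ∧
    NetworkCreation.priceOfAnarchy n α ≤
      ENNReal.ofReal (3 + 2 * (n : ℝ) / (2 * (n : ℝ) + α)) ∧
    NetworkCreation.priceOfAnarchy n α ≤ 5 := by
  have hbound : NetworkCreation.priceOfAnarchy n α ≤
      ENNReal.ofReal (3 + 2 * (n : ℝ) / (2 * (n : ℝ) + α)) := by
    refine ENNReal.div_le_of_le_mul (iSup₂_le fun s hs => ?_)
    rw [NetworkCreation.optCost, ENNReal.mul_iInf_of_ne (by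
      rw [Ne, ENNReal.ofReal_eq_zero, not_le]; positivity) ENNReal.ofReal_ne_top]
    refine le_iInf fun t => ?_
    have := hs.socialCost_le_mul hpos (by rwa [Fintype.card_fin]) (by rwa [Fintype.card_fin]) t
    rwa [Fintype.card_fin] at this
  refine ⟨?_, hbound, hbound.trans ?_⟩
  · rcases le_total 1 α with h | h
    · exact ⟨_, NetworkCreation.isNash_star h ⟨0, by omega⟩⟩
    · exact ⟨_, NetworkCreation.isNash_complete (by omega) hpos h⟩
  · rw [← ENNReal.ofReal_ofNat 5]
    refine ENNReal.ofReal_le_ofReal ?_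
    have h1 : 2 * (n : ℝ) / (2 * (n : ℝ) + α) ≤ 1 := by
      rw [div_le_one (by positivity)]
      linarith
    linarith
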